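/- **Theorem (Cable-driven actuation).** Consider a soft arm made of $N$ consecutive sections with lengths $\ell_i>0$ and total length $L=\sum_i\ell_i$, section $i$ having constant strain twist $\xi_i\in\mathbb{R}^6$ (angular components first). Let $q=(\xi_1,\dots,\xi_N)\in\mathbb{R}^{6N}$. Let $g(X)\in SE(3)$, $X\in[0,L]$, be the pose relative to the base, i.e. $\partial_X g=g\,\breve\xi_i$ on section $i$ and $g(0)=I$, where $\breve{\ }:\mathbb{R}^6\to\mathfrak{se}(3)$ is the usual isomorphism, and let $J=J(q,X)$ be the geometric Jacobian, so that the body twist $\eta$ given by $\breve\eta=g^{-1}\partial_t g$ satisfies $\eta=J\dot q$; explicitly $J(q,X)\dot q=\mathrm{Ad}_{g(X)}^{-1}\int_0^X \mathrm{Ad}_{g(s)}\dot\xi(s)\,ds$, with $\dot\xi(s)=\dot\xi_i$ on section $i$. Let $\dot J$ be the time derivative of $J$ along the motion, and $\mathrm{ad}^\star_\eta=-\mathrm{ad}_\eta^{\top}$. Let $\mathcal M(X)=\rho\,\mathrm{diag}(I_x,I_y,I_z,A,A,A)$ with body density $\rho>0$ and positive $I_x,I_y,I_z,A$, let the added-mass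 matrix $\mathcal M_f(X)$ be symmetric positive semidefinite, put $\mathcal M_a=\mathcal M+\mathcal M_f$, and let the drag matrix $\mathcal D(X)$ satisfy $x^\top\mathcal D(X)x\ge 0$ for all $x\in\mathbb{R}^6$ (all these data may depend on $X$ and are integrable on $[0,L]$, but do not depend on $q$ or on time). Let a constant wrench $\mathcal F_p$ be applied at an abscissa $\bar X\in[0,L]$. Let $\rho_f$ be the fluid density, $\mathcal G\in\mathbb{R}^6$ the gravity twist and $g_r$ the base frame. With $\|\cdot\|_p$ the Euclidean norm of the translational part of a twist, put $$M(q)=\int_0^L J^\top\mathcal M_aJ\,dX,\quad C_1(q,\dot q)=\int_0^L J^\top\mathrm{ad}^\star_{J\dot q}\mathcal M_aJ\,dX,\quad C_2(q,\dot q)=\int_0^L J^\top\mathcal M_a\dot J\,dX,$$ $$D(q,\dot q)=\int_0^L J^\top\mathcal D J\,\|J\dot q\|_p\,dX,\quad N(q)=\Bigl(1-\frac{\rho_f}{\rho}\Bigr)\int_0^L J^\top\mathcal M\,\mathrm{Ad}_{g}^{-1}dX,\quad F(q)=J(q,\bar X)^\top\mathcal F_p .$$ The piecewise constant strain (PCS)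 dynamics with the generalized torque as control input $u$ is $$M(q)\ddot q+[C_1(q,\dot q)+C_2(q,\dot q)]\dot q=u+F(q)+N(q)\mathrm{Ad}_{g_r}^{-1}\mathcal G-D(q,\dot q)\dot q .$$ Assume that there is no gravity/buoyancy load, i.e. $N(q)\mathrm{Ad}_{g_r}^{-1}\mathcal G=0$ for all $q$. Let $K_p$ be a diagonal matrix with positive entries and let $K_D$ be a damping matrix, i.e. $v^\top K_Dv>0$ for all $v\ne0$ (for instance a positive diagonal matrix). Then for every $q^d\in\mathbb{R}^{6N}$ the control law $$u(q,\dot q)=-K_p(q-q^d)-K_D\dot q-F(q)$$ makes $(q,\dot q)=(q^d,0)$ a globally asymptotically stable equilibrium of the closed-loop system: $(q^d,0)$ is an equilibrium; from every initial state there is a solution for all $t\ge0$, and a solution on any interval $[0,T)$ is determined by its initial state; $(q^d,0)$ is Lyapunov stable; and every solution converges to $(q^d,0)$ as $t\to\infty$. -/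

import Mathlib

open Filter Topology MeasureTheory Matrix

noncomputable section

namespace PCS

/-! ### Screws: coordinates `(angular, linear)` on `se(3)` and its dual -/

/-- Indices of a screw in `ℝ⁶`: `Sum.inl` is the angular part, `Sum.inr` the linear part. -/
abbrev Idx := Fin 3 ⊕ Fin 3

/-- Coordinates of a twist or of a wrench. -/
abbrev Screw := Idx → ℝ

/-- Homogeneous `4 × 4` matrices. -/
abbrev Hom := Matrix (Fin 3 ⊕ Unit) (Fin 3 ⊕ Unit) ℝ

/-- The antisymmetric matrix of `w`, that is `hat w *ᵥ x = w × x`. -/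
def hat (w : Fin 3 → ℝ) : Matrix (Fin 3) (Fin 3) ℝ :=
  !![0, -w 2, w 1; w 2, 0, -w 0; -w 1, w 0, 0]

/-- Angular part of a screw. -/
def ang (x : Screw) : Fin 3 → ℝ := fun k => x (Sum.inl k)

/-- Linear part of a screw. -/
def lin (x : Screw) : Fin 3 → ℝ := fun k => x (Sum.inr k)

/-- The isomorphism from `ℝ⁶` onto `se(3)`, as homogeneous matrices. -/
def toSE3 (x : Screw) : Hom :=
  Matrix.fromBlocks (hat (ang x)) (Matrix.replicateCol Unit (lin x)) 0 0

/-- Rotation part `R` of a pose `g = [R, p; 0, 1]`. -/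
def rot (g : Hom) : Matrix (Fin 3) (Fin 3) ℝ := g.toBlocks₁₁

/-- Position part `p` of a pose `g = [R, p; 0, 1]`. -/
def pos (g : Hom) : Fin 3 → ℝ := fun k => g (Sum.inl k) (Sum.inr ())

/-- The adjoint matrix `Ad_g = [R, 0; hat p * R, R]`. -/
def Ad (g : Hom) : Matrix Idx Idx ℝ :=
  Matrix.fromBlocks (rot g) 0 (hat (pos g) * rot g) (rot g)

/-- The adjoint matrix of a twist, `ad_x = [hat ω, 0; hat v, hat ω]` for `x = (ω, v)`. -/
def ad (x : Screw) : Matrix Idx Idx ℝ :=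
  Matrix.fromBlocks (hat (ang x)) 0 (hat (lin x)) (hat (ang x))

/-- The coadjoint matrix of a twist, `ad*_x = - ad_xᵀ = [hat ω, hat v; 0, hat ω]`. -/
def coad (x : Screw) : Matrix Idx Idx ℝ := -(ad x)ᵀ

/-- The Euclidean norm of the translational part of a twist. -/
def transNorm (x : Screw) : ℝ := Real.sqrt (∑ k, lin x k ^ 2)

/-- The integral of a matrix-valued function, taken entry by entry. -/
def matInt {m n : Type*} (a b : ℝ) (f : ℝ → Matrix m n ℝ) : Matrix m n ℝ :=
  Matrix.of fun i j => ∫ X in a..b, f X i j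

/-- The pose of the base frame in the inertial frame. -/
def baseFrame : Hom :=
  Matrix.fromBlocks !![0, -1, 0; 1, 0, 0; 0, 0, 1] 0 0 1

/-! ### The arm -/

/-- Physical data of a soft arm made of `N` sections of constant strain. Every sectional quantity
may vary along the arm with the material abscissa `X ∈ [0, L]`. -/
structure Arm (N : ℕ) where
  /-- lengths of the sections -/
  len : Fin N → ℝ
  len_pos : ∀ i, 0 < len i
  /-- body density `ρ` -/
  rho : ℝ
  rho_pos : 0 < rho
  /-- fluid density `ρ_f` -/
  rhoFluid : ℝ
  /-- second moments of area `I_x, I_y, I_z` -/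
  inertia : ℝ → Fin 3 → ℝ
  inertia_pos : ∀ X ∈ Set.Icc 0 (∑ i, len i), ∀ k, 0 < inertia X k
  inertia_int : ∀ k, IntervalIntegrable (fun X => inertia X k) volume 0 (∑ i, len i)
  /-- cross-sectional area `A` -/
  area : ℝ → ℝ
  area_pos : ∀ X ∈ Set.Icc 0 (∑ i, len i), 0 < area X
  area_int : IntervalIntegrable area volume 0 (∑ i, len i)
  /-- added mass of the fluid, `𝓜_f` -/
  addedMass : ℝ → Matrix Idx Idx ℝ
  addedMass_psd : ∀ X ∈ Set.Icc 0 (∑ i, len i), (addedMass X).PosSemidef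
  addedMass_int : ∀ a b,
    IntervalIntegrable (fun X => addedMass X a b) volume 0 (∑ i, len i)
  /-- drag matrix `𝓓` -/
  drag : ℝ → Matrix Idx Idx ℝ
  drag_nonneg : ∀ X ∈ Set.Icc 0 (∑ i, len i), ∀ x : Screw, 0 ≤ x ⬝ᵥ (drag X *ᵥ x)
  drag_int : ∀ a b, IntervalIntegrable (fun X => drag X a b) volume 0 (∑ i, len i)
  /-- the abscissa `X̄` where the external wrench is applied -/
  tip : ℝ
  tip_mem : tip ∈ Set.Icc 0 (∑ i, len i)
  /-- the wrench `𝓕_p` applied at `X̄` -/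
  wrench : Screw
  /-- the gravitational acceleration twist `𝓖`, in the inertial frame -/
  gravity : Screw

/-- Joint space `ℝ^{6N}`: the coordinates of `q` are the strain twists `ξ₁, …, ξ_N`. -/
abbrev Joint (N : ℕ) := Fin N × Idx → ℝ

namespace Arm

variable {N : ℕ} (A : Arm N)

/-- Total length of the arm. -/
def total : ℝ := ∑ i, A.len i

/-- Abscissa at which section `i` starts. -/
def start (i : Fin N) : ℝ := ∑ j ∈ Finset.Iio i, A.len j

/-- Length of the part of section `i` that lies between the base and the abscissa `X`:
`0` before the section, `X - start i` inside it, `len i` after it. -/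
def part (i : Fin N) (X : ℝ) : ℝ := max 0 (min (A.len i) (X - A.start i))

/-- The pose `g(X)` with respect to the base frame. It is the solution of `∂g/∂X = g ξ̆(X)`,
`g(0) = 1`, for the strain field with the constant value `ξ_i` on section `i`: the ordered product
`exp(ℓ₁ ξ̆₁) ⋯ exp(ℓ_{n-1} ξ̆_{n-1}) exp((X - start n) ξ̆_n)` when `X` lies in section `n`. -/
def pose (q : Joint N) (X : ℝ) : Hom :=
  (List.ofFn fun i : Fin N =>
    NormedSpace.exp (A.part i X • toSE3 fun a => q (i, a))).prod

/-- The geometric Jacobian `J(X)` at `q`: the body twist `η`, given by `η̆ = g⁻¹ ∂g/∂t`, equals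
`J q̇`. It is the solution of `∂η/∂X = ξ̇ - ad_ξ η`, `η(0) = 0`, that is
`η(X) = Ad_{g(X)}⁻¹ ∫₀^X Ad_{g(s)} ξ̇(s) ds`; block `i` collects the part of the integral over
section `i`, where `ξ̇(s) = q̇_i`. -/
def jac (q : Joint N) (X : ℝ) : Matrix Idx (Fin N × Idx) ℝ :=
  Matrix.of fun a ib =>
    ((Ad (A.pose q X))⁻¹ *
      matInt (A.start ib.1) (A.start ib.1 + A.part ib.1 X) fun s => Ad (A.pose q s)) a ib.2

/-- `J̇`: the time derivative of `J(X)` along a motion that passes through `q` with velocity `v`. -/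
def jacDot (q v : Joint N) (X : ℝ) : Matrix Idx (Fin N × Idx) ℝ :=
  Matrix.of fun a ib => deriv (fun t : ℝ => A.jac (q + t • v) X a ib) 0

/-- Screw mass inertia matrix `𝓜(X) = ρ diag(I_x, I_y, I_z, A, A, A)`. -/
def mass (X : ℝ) : Matrix Idx Idx ℝ :=
  A.rho • Matrix.diagonal (Sum.elim (A.inertia X) fun _ => A.area X)

/-- `𝓜_a = 𝓜 + 𝓜_f`. -/
def massTot (X : ℝ) : Matrix Idx Idx ℝ := A.mass X + A.addedMass X

/-- `M(q) = ∫ Jᵀ 𝓜_a J dX`. -/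
def M (q : Joint N) : Matrix (Fin N × Idx) (Fin N × Idx) ℝ :=
  matInt 0 A.total fun X => (A.jac q X)ᵀ * A.massTot X * A.jac q X

/-- `C₁(q, q̇) = ∫ Jᵀ ad*_{J q̇} 𝓜_a J dX`. -/
def C₁ (q v : Joint N) : Matrix (Fin N × Idx) (Fin N × Idx) ℝ :=
  matInt 0 A.total fun X =>
    (A.jac q X)ᵀ * coad (A.jac q X *ᵥ v) * A.massTot X * A.jac q X

/-- `C₂(q, q̇) = ∫ Jᵀ 𝓜_a J̇ dX`. -/
def C₂ (q v : Joint N) : Matrix (Fin N × Idx) (Fin N × Idx) ℝ :=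
  matInt 0 A.total fun X => (A.jac q X)ᵀ * A.massTot X * A.jacDot q v X

/-- `D(q, q̇) = ∫ Jᵀ 𝓓 J ‖J q̇‖_p dX`. -/
def D (q v : Joint N) : Matrix (Fin N × Idx) (Fin N × Idx) ℝ :=
  matInt 0 A.total fun X =>
    transNorm (A.jac q X *ᵥ v) • ((A.jac q X)ᵀ * A.drag X * A.jac q X)

/-- `N(q) = (1 - ρ_f / ρ) ∫ Jᵀ 𝓜 Ad_g⁻¹ dX`. -/
def gravMat (q : Joint N) : Matrix (Fin N × Idx) Idx ℝ :=
  (1 - A.rhoFluid / A.rho) •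
    matInt 0 A.total fun X => (A.jac q X)ᵀ * A.mass X * (Ad (A.pose q X))⁻¹

/-- The gravity and buoyancy load `N(q) Ad_{g_r}⁻¹ 𝓖`. -/
def gravLoad (q : Joint N) : Joint N :=
  A.gravMat q *ᵥ ((Ad baseFrame)⁻¹ *ᵥ A.gravity)

/-- The external load `F(q) = J(X̄)ᵀ 𝓕_p`. -/
def F (q : Joint N) : Joint N := (A.jac q A.tip)ᵀ *ᵥ A.wrench

/-- `z = (q, q̇)` is, on the time interval `I`, a motion of the arm
`M(q) q̈ + [C₁ + C₂] q̇ = u(q, q̇) + F(q) + N(q) Ad_{g_r}⁻¹ 𝓖 - D(q, q̇) q̇`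
whose generalized torque is given by the feedback law `u`. -/
def IsMotion (u : Joint N → Joint N → Joint N) (I : Set ℝ) (z : ℝ → Joint N × Joint N) : Prop :=
  ∃ acc : ℝ → Joint N, ∀ t ∈ I,
    HasDerivWithinAt z ((z t).2, acc t) I t ∧
    A.M (z t).1 *ᵥ acc t + (A.C₁ (z t).1 (z t).2 + A.C₂ (z t).1 (z t).2) *ᵥ (z t).2 =
      u (z t).1 (z t).2 + A.F (z t).1 + A.gravLoad (z t).1 - A.D (z t).1 (z t).2 *ᵥ (z t).2

/-- The control law `u(q, q̇) = -K_p (q - q^d) - K_D q̇ - F(q)`. -/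
def pdLaw (Kp KD : Matrix (Fin N × Idx) (Fin N × Idx) ℝ) (qd : Joint N)
    (q v : Joint N) : Joint N :=
  -(Kp *ᵥ (q - qd)) - KD *ᵥ v - A.F q

end Arm

/-! ### Global asymptotic stability -/

/-- `x` is a globally asymptotically stable equilibrium of the time-invariant system whose
solutions on a time interval `I` are the `z` with `Sol I z`. -/
structure IsGAS {E : Type*} [TopologicalSpace E] (Sol : Set ℝ → (ℝ → E) → Prop) (x : E) :
    Prop where
  /-- `x` is an equilibrium. -/
  equilibrium : Sol (Set.Ici 0) fun _ => x
  /-- Every initial state has a solution for all future times. -/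
  complete : ∀ x₀, ∃ z, z 0 = x₀ ∧ Sol (Set.Ici 0) z
  /-- A solution, on whatever interval `[0, T)`, is determined by its initial state. -/
  unique : ∀ (T : ℝ) (z z' : ℝ → E), Sol (Set.Ico 0 T) z → Sol (Set.Ico 0 T) z' → z 0 = z' 0 →
    Set.EqOn z z' (Set.Ico 0 T)
  /-- `x` is stable in the sense of Lyapunov. -/
  stable : ∀ U ∈ 𝓝 x, ∃ W ∈ 𝓝 x, ∀ z, Sol (Set.Ici 0) z → z 0 ∈ W → ∀ t, 0 ≤ t → z t ∈ U
  /-- Every solution converges to `x`. -/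
  attractive : ∀ z, Sol (Set.Ici 0) z → Tendsto z atTop (𝓝 x)

end PCS

end

open Filter Topology MeasureTheory Matrix

noncomputable section

namespace PCS

/-! ### Autonomous differential equations with a Lyapunov function -/

section Lyapunov

variable {E : Type*} [NormedAddCommGroup E] [NormedSpace ℝ E]

/-! The Lyapunov function is `energy`, the kinetic energy plus the spring energy of the proportional
action. Along the closed loop its derivative is `-vᵀ K_D v - vᵀ D v ≤ 0`
(`fderiv_energy_closedLoop`). Three facts produce this balance: `F` is cancelled by the control law,
`C₁` does no work because `ad_η η = 0` (`dotProduct_C₁_mulVec`), and the derivative of `M` is `C₂ᵀ +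
C₂` because only `J` depends on `q` (`hasDerivAt_M`), so that `C₂` cancels against half of it.

The balance is blind to position errors at rest, so the energy is not a strict Lyapunov function and
LaSalle's principle is needed (`isGAS_of_lyapunov`). A motion without dissipation has zero velocity,
hence zero acceleration, hence `K_p (q - q^d) = 0`.

The principle requires compact energy sublevels and an ordinary differential equation, hence a
positive definite `M` (`M_pos`). This reduces to injectivity of `v ↦ J v` as a function of the
abscissa (`eq_zero_of_jac_mulVec_eq_zero`). The vector field must also be locally Lipschitz,
although the sectional data are only integrable in `X` and the drag contains a norm. `SmoothFamily`
serves this purpose: `q ↦ J(q, ·)` is smooth into the Banach algebra of bounded continuous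
functions, and integration against an integrable weight is a continuous linear functional on it. -/

/-- `z` solves `z' = f z` on `I`. -/
def IsSol (f : E → E) (I : Set ℝ) (z : ℝ → E) : Prop :=
  ∀ t ∈ I, HasDerivWithinAt z (f (z t)) I t

theorem IsSol.hasDerivWithinAt_Ici {f : E → E} {T : ℝ} {z : ℝ → E} (hz : IsSol f (Set.Ico 0 T) z)
    {t : ℝ} (ht : t ∈ Set.Ico 0 T) : HasDerivWithinAt z (f (z t)) (Set.Ici t) t := by
  refine (hz t ht).mono_of_mem_nhdsWithin ?_
  filter_upwards [self_mem_nhdsWithin, nhdsWithin_le_nhds (Iio_mem_nhds ht.2)] with s hs hs'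
  exact ⟨ht.1.trans hs, hs'⟩

theorem IsSol.continuousOn {f : E → E} {I : Set ℝ} {z : ℝ → E} (hz : IsSol f I z) :
    ContinuousOn z I := fun t ht => (hz t ht).continuousWithinAt

theorem IsSol.mono_Ico {f : E → E} {z : ℝ → E} (hz : IsSol f (Set.Ici 0) z) (T : ℝ) :
    IsSol f (Set.Ico 0 T) z := fun t ht => (hz t ht.1).mono Set.Ico_subset_Ici_self

theorem IsSol.shift {f : E → E} {z : ℝ → E} (hz : IsSol f (Set.Ici 0) z) {s : ℝ} (hs : 0 ≤ s) :
    IsSol f (Set.Ici 0) fun t => z (s + t) := by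
  intro t ht
  have h := hz (s + t) (add_nonneg hs ht)
  have h2 : HasDerivWithinAt (fun t : ℝ => s + t) 1 (Set.Ici 0) t :=
    ((hasDerivAt_id t).const_add s).hasDerivWithinAt
  have := HasDerivWithinAt.scomp t h h2 (fun x hx => add_nonneg hs hx)
  simpa using! this

/-- Grönwall's inequality. It gives both uniqueness and the continuous dependence on initial data
used in LaSalle's argument. -/
theorem IsSol.dist_le {f : E → E} {s : Set E} {K : NNReal} (hf : LipschitzOnWith K f s)
    {T : ℝ} {z z' : ℝ → E} (hz : IsSol f (Set.Ico 0 T) z) (hz' : IsSol f (Set.Ico 0 T) z')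
    (hs : ∀ t ∈ Set.Ico 0 T, z t ∈ s) (hs' : ∀ t ∈ Set.Ico 0 T, z' t ∈ s) {t : ℝ}
    (ht : t ∈ Set.Ico 0 T) : dist (z t) (z' t) ≤ dist (z 0) (z' 0) * Real.exp (K * t) := by
  have hsub : Set.Icc 0 t ⊆ Set.Ico 0 T := fun x hx => ⟨hx.1, hx.2.trans_lt ht.2⟩
  have := dist_le_of_trajectories_ODE_of_mem (v := fun _ => f) (s := fun _ => s) (a := 0) (b := t)
    (K := K) (fun _ _ => hf) (hz.continuousOn.mono hsub)
    (fun r hr => hz.hasDerivWithinAt_Ici (hsub (Set.Ico_subset_Icc_self hr)))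
    (fun r hr => hs r (hsub (Set.Ico_subset_Icc_self hr)))
    (hz'.continuousOn.mono hsub)
    (fun r hr => hz'.hasDerivWithinAt_Ici (hsub (Set.Ico_subset_Icc_self hr)))
    (fun r hr => hs' r (hsub (Set.Ico_subset_Icc_self hr))) le_rfl t ⟨ht.1, le_rfl⟩
  simpa using this

theorem IsSol.eqOn {f : E → E} (hf : LocallyLipschitz f) {T : ℝ} {z z' : ℝ → E}
    (hz : IsSol f (Set.Ico 0 T) z) (hz' : IsSol f (Set.Ico 0 T) z') (h0 : z 0 = z' 0) :
    Set.EqOn z z' (Set.Ico 0 T) := by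
  intro t ht
  -- Stopping at `b < T` makes both trajectories compact, so one Lipschitz constant serves them
  -- both.
  obtain ⟨b, hb, hbT⟩ := exists_between ht.2
  have hsub : Set.Icc 0 b ⊆ Set.Ico 0 T := fun x hx => ⟨hx.1, hx.2.trans_lt hbT⟩
  have hsub' : Set.Ico 0 b ⊆ Set.Ico 0 T := Set.Ico_subset_Icc_self.trans hsub
  have hc := (isCompact_Icc.image_of_continuousOn (hz.continuousOn.mono hsub)).union
    (isCompact_Icc.image_of_continuousOn (hz'.continuousOn.mono hsub))
  obtain ⟨K, hK⟩ := hf.locallyLipschitzOn.exists_lipschitzOnWith_of_compact hc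
  have := IsSol.dist_le hK (T := b) (fun r hr => (hz r (hsub' hr)).mono hsub')
    (fun r hr => (hz' r (hsub' hr)).mono hsub')
    (fun r hr => Or.inl ⟨r, Set.Ico_subset_Icc_self hr, rfl⟩)
    (fun r hr => Or.inr ⟨r, Set.Ico_subset_Icc_self hr, rfl⟩) ⟨ht.1, hb⟩
  rw [h0, dist_self, zero_mul] at this
  exact dist_le_zero.1 this

theorem IsSol.hasDerivWithinAt_comp {f : E → E} {V : E → ℝ} {V' : E → E →L[ℝ] ℝ}
    (hV : ∀ x, HasFDerivAt V (V' x) x) {I : Set ℝ} {z : ℝ → E} (hz : IsSol f I z) {t : ℝ}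
    (ht : t ∈ I) : HasDerivWithinAt (fun s => V (z s)) (V' (z t) (f (z t))) I t :=
  (hV (z t)).comp_hasDerivWithinAt t (hz t ht)

theorem IsSol.antitoneOn {f : E → E} {V : E → ℝ} {V' : E → E →L[ℝ] ℝ}
    (hV : ∀ x, HasFDerivAt V (V' x) x) (hdec : ∀ x, V' x (f x) ≤ 0) {z : ℝ → E}
    (hz : IsSol f (Set.Ici 0) z) : AntitoneOn (fun s => V (z s)) (Set.Ici 0) := by
  have h := fun t (ht : t ∈ Set.Ici (0 : ℝ)) => hz.hasDerivWithinAt_comp hV ht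
  refine antitoneOn_of_deriv_nonpos (convex_Ici 0) (fun t ht => (h t ht).continuousWithinAt)
    (fun t ht => ?_) (fun t ht => ?_)
  · exact ((h t (interior_subset ht)).mono interior_subset).differentiableWithinAt
  · rw [interior_Ici] at ht
    rw [((h t (Set.Ioi_subset_Ici_self ht)).hasDerivAt (Ici_mem_nhds ht)).deriv]
    exact hdec _

variable [FiniteDimensional ℝ E]

/-- With speed at most `C`, a solution cannot leave the ball of radius `C * T` before time `T`, so
Picard–Lindelöf applies on the whole of `[0, T]` at once. -/
theorem exists_isSol_Icc_of_bounded {f : E → E} (hf : LocallyLipschitz f) {C : ℝ}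
    (hC : ∀ x, ‖f x‖ ≤ C) (x₀ : E) {T : ℝ} (hT : 0 ≤ T) :
    ∃ z, z 0 = x₀ ∧ IsSol f (Set.Icc 0 T) z := by
  have : ProperSpace E := FiniteDimensional.proper ℝ E
  have : CompleteSpace E := FiniteDimensional.complete ℝ E
  have hC0 : 0 ≤ C := (norm_nonneg _).trans (hC x₀)
  lift C to NNReal using hC0
  obtain ⟨K, hK⟩ := hf.locallyLipschitzOn.exists_lipschitzOnWith_of_compact
    (isCompact_closedBall x₀ ((C * ⟨T, hT⟩ : NNReal) : ℝ))
  have hp : IsPicardLindelof (fun _ => f) (⟨0, le_rfl, hT⟩ : Set.Icc 0 T) x₀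
      (C * ⟨T, hT⟩ : NNReal) 0 C K :=
    IsPicardLindelof.of_time_independent (fun x _ => hC x) hK (by
      rw [sub_zero, sub_self, max_eq_left hT, NNReal.coe_zero, sub_zero]; exact le_rfl)
  exact hp.exists_eq_forall_mem_Icc_hasDerivWithinAt₀

theorem exists_isSol_of_bounded {f : E → E} (hf : LocallyLipschitz f) {C : ℝ}
    (hC : ∀ x, ‖f x‖ ≤ C) (x₀ : E) : ∃ z, z 0 = x₀ ∧ IsSol f (Set.Ici 0) z := by
  choose y hy0 hy using fun n : ℕ =>
    exists_isSol_Icc_of_bounded hf hC x₀ (T := (n : ℝ) + 1) (by positivity)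
  have key : ∀ (n : ℕ) (s : ℝ), 0 ≤ s → s < n + 1 → y ⌊s⌋₊ s = y n s := by
    intro n s hs hsn
    have hle : ⌊s⌋₊ ≤ n := Nat.lt_succ_iff.1 ((Nat.floor_lt hs).2 (by exact_mod_cast hsn))
    have hle' : ((⌊s⌋₊ : ℝ)) + 1 ≤ n + 1 := by exact_mod_cast Nat.succ_le_succ hle
    refine IsSol.eqOn hf (T := (⌊s⌋₊ : ℝ) + 1) (z := y ⌊s⌋₊) (z' := y n)
      (fun t ht => (hy _ t (Set.Ico_subset_Icc_self ht)).mono Set.Ico_subset_Icc_self)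
      (fun t ht => ?_) ((hy0 _).trans (hy0 _).symm) ⟨hs, Nat.lt_floor_add_one s⟩
    have hsub : Set.Ico (0 : ℝ) ((⌊s⌋₊ : ℝ) + 1) ⊆ Set.Icc 0 (n + 1) :=
      fun r hr => ⟨hr.1, hr.2.le.trans hle'⟩
    exact (hy n t (hsub ht)).mono hsub
  -- The piece `y n` lives on `[0, n + 1]`, so `y ⌊t⌋₊` is defined beyond `t`. By `key` it agrees
  -- with the glued function on all of `[0, ⌊t⌋₊ + 1)`, on both sides of an integer `t`.
  refine ⟨fun t => y ⌊t⌋₊ t, by simp [hy0], fun t ht => ?_⟩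
  have ht0 : (0 : ℝ) ≤ t := ht
  have hlt := Nat.lt_floor_add_one t
  have h1 : HasDerivWithinAt (y ⌊t⌋₊) (f (y ⌊t⌋₊ t)) (Set.Ici 0) t := by
    refine (hy _ t ⟨ht0, hlt.le⟩).mono_of_mem_nhdsWithin ?_
    filter_upwards [self_mem_nhdsWithin, nhdsWithin_le_nhds (Iio_mem_nhds hlt)] with s hs hs'
    exact ⟨hs, le_of_lt hs'⟩
  refine h1.congr_of_eventuallyEq ?_ rfl
  filter_upwards [self_mem_nhdsWithin, nhdsWithin_le_nhds (Iio_mem_nhds hlt)] with s hs hs'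
  exact key _ s hs hs'

/-- Multiplying `f` by a cutoff `χ ≥ 0` makes it bounded and keeps `V` nonincreasing. The solution
therefore stays in the initial sublevel set, where `χ = 1` and the field is still `f`. -/
theorem exists_isSol_of_lyapunov {f : E → E} (hf : LocallyLipschitz f) {V : E → ℝ}
    {V' : E → E →L[ℝ] ℝ} (hV : ∀ x, HasFDerivAt V (V' x) x) (hdec : ∀ x, V' x (f x) ≤ 0)
    (hcomp : ∀ c, IsCompact {x | V x ≤ c}) (x₀ : E) :
    ∃ z, z 0 = x₀ ∧ IsSol f (Set.Ici 0) z := by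
  have : ProperSpace E := FiniteDimensional.proper ℝ E
  obtain ⟨R, hR⟩ := (hcomp (V x₀)).isBounded.exists_norm_le
  set χ : E → ℝ := fun x => max 0 (min 1 (R + 1 - ‖x‖)) with hχ
  have hχl : LocallyLipschitz χ := by
    refine (LocallyLipschitz.const_min ?_ 1).const_max 0
    have h1 : LocallyLipschitz fun x : E => ‖x‖ := lipschitzWith_one_norm.locallyLipschitz
    have h2 : ContDiff ℝ 1 fun r : ℝ => R + 1 - r := by fun_prop
    exact h2.locallyLipschitz.comp h1
  have hgl : LocallyLipschitz fun x => χ x • f x := by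
    have h2 : ContDiff ℝ 1 fun p : ℝ × E => p.1 • p.2 := contDiff_fst.smul contDiff_snd
    exact h2.locallyLipschitz.comp (hχl.prodMk hf)
  have hχ0 : ∀ x, 0 ≤ χ x := fun x => le_max_left _ _
  have hχ1 : ∀ x, χ x ≤ 1 := fun x => max_le zero_le_one (min_le_left _ _)
  obtain ⟨C, hC⟩ := (isCompact_closedBall (0 : E) (R + 1)).exists_bound_of_continuousOn
    hf.continuous.continuousOn
  have hb : ∀ x, ‖χ x • f x‖ ≤ max C 0 := by
    intro x
    rw [norm_smul, Real.norm_of_nonneg (hχ0 x)]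
    by_cases hx : ‖x‖ ≤ R + 1
    · calc χ x * ‖f x‖ ≤ 1 * ‖f x‖ := by gcongr; exact hχ1 x
        _ ≤ max C 0 := by rw [one_mul]; exact (hC x (by simpa using hx)).trans (le_max_left _ _)
    · have : χ x = 0 := max_eq_left (min_le_of_right_le (by linarith))
      simp [this]
  obtain ⟨z, hz0, hz⟩ := exists_isSol_of_bounded hgl hb x₀
  refine ⟨z, hz0, fun t ht => ?_⟩
  have hanti := hz.antitoneOn hV (fun x => by
    rw [map_smul]; exact mul_nonpos_of_nonneg_of_nonpos (hχ0 x) (hdec x))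
  have hle : V (z t) ≤ V x₀ := hz0 ▸ hanti Set.self_mem_Ici ht ht
  have : χ (z t) = 1 := by
    have := hR (z t) hle
    simp only [hχ]
    rw [min_eq_left (by linarith), max_eq_right zero_le_one]
  simpa [this] using hz t ht

/-- If `V ≥ c` forever, `V` tends to some `l ≥ c` along `z`. The solution issued from a limit point
`x` of `z` then has constant `V = l`, so it does not dissipate and `hinv` forces `x = x₀`. This
contradicts `V x₀ < c`. -/
theorem IsSol.exists_lt_of_lyapunov {f : E → E} (hf : LocallyLipschitz f) {V : E → ℝ}
    {V' : E → E →L[ℝ] ℝ} (hV : ∀ x, HasFDerivAt V (V' x) x) (hdec : ∀ x, V' x (f x) ≤ 0)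
    (hcomp : ∀ c, IsCompact {x | V x ≤ c}) {x₀ : E}
    (hinv : ∀ y, IsSol f (Set.Ici 0) y → (∀ t, 0 ≤ t → V' (y t) (f (y t)) = 0) → y 0 = x₀)
    {z : ℝ → E} (hz : IsSol f (Set.Ici 0) z) {c : ℝ} (hc : V x₀ < c) :
    ∃ t, 0 ≤ t ∧ V (z t) < c := by
  by_contra! hge
  have hVc : Continuous V := continuous_iff_continuousAt.2 fun x => (hV x).continuousAt
  have hanti := hz.antitoneOn hV hdec
  have hmem : ∀ t, 0 ≤ t → z t ∈ {x | V x ≤ V (z 0)} := fun t ht => hanti Set.self_mem_Ici ht ht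
  obtain ⟨x, hx, φ, hφ, hlim⟩ := (hcomp (V (z 0))).tendsto_subseq
    (fun n : ℕ => hmem n (Nat.cast_nonneg n))
  -- the Lyapunov function converges along the trajectory
  have hex : ∃ l, Tendsto (fun t : Set.Ici (0 : ℝ) => V (z t)) atTop (𝓝 l) :=
    ⟨_, tendsto_atTop_ciInf (fun a b hab => hanti a.2 b.2 hab)
      ⟨c, by rintro _ ⟨t, rfl⟩; exact hge t t.2⟩⟩
  obtain ⟨l, hl⟩ := hex
  have hlt : ∀ s : ℝ, 0 ≤ s → Tendsto (fun n : ℕ => V (z (φ n + s))) atTop (𝓝 l) := by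
    intro s hs
    have : Tendsto (fun n : ℕ => (⟨φ n + s, add_nonneg (Nat.cast_nonneg _) hs⟩ : Set.Ici (0 : ℝ))) atTop atTop := by
      rw [tendsto_atTop]
      rintro ⟨b, hb⟩
      filter_upwards [(tendsto_natCast_atTop_atTop.comp hφ.tendsto_atTop).eventually_ge_atTop b]
        with n hn
      have : b ≤ (φ n : ℝ) + s := le_add_of_le_of_nonneg hn hs
      exact this
    exact hl.comp this
  have hVx : V x = l := tendsto_nhds_unique (hVc.continuousAt.tendsto.comp hlim)
    (by simpa [Function.comp_def] using! hlt 0 le_rfl)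
  obtain ⟨y, hy0, hy⟩ := exists_isSol_of_lyapunov hf hV hdec hcomp x
  have hymem : ∀ t, 0 ≤ t → y t ∈ {x | V x ≤ V (z 0)} := fun t ht =>
    (hy.antitoneOn hV hdec Set.self_mem_Ici ht ht).trans (by simpa only [hy0] using! hx)
  obtain ⟨K, hK⟩ := hf.locallyLipschitzOn.exists_lipschitzOnWith_of_compact (hcomp (V (z 0)))
  have hconst : ∀ s, 0 ≤ s → V (y s) = l := by
    intro s hs
    have hzy : Tendsto (fun n : ℕ => z (φ n + s)) atTop (𝓝 (y s)) := by
      rw [tendsto_iff_dist_tendsto_zero]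
      -- The shifted trajectory `z (φ n + ·)` and `y` stay in one compact sublevel set, so
      -- Grönwall's constant does not depend on `n`.
      refine squeeze_zero (g := fun n => dist (z (φ n)) x * Real.exp (K * s))
        (fun n => dist_nonneg) (fun n => ?_) ?_
      · have := IsSol.dist_le hK ((hz.shift (Nat.cast_nonneg (φ n))).mono_Ico (s + 1))
          (hy.mono_Ico (s + 1)) (fun t ht => hmem _ (add_nonneg (Nat.cast_nonneg _) ht.1))
          (fun t ht => hymem _ ht.1) (t := s) ⟨hs, by linarith⟩
        simpa [hy0] using this
      · have := (tendsto_iff_dist_tendsto_zero.1 hlim).mul_const (Real.exp (K * s))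
        simpa using! this
    exact tendsto_nhds_unique (hVc.continuousAt.tendsto.comp hzy) (hlt s hs)
  have hzero : ∀ t, 0 ≤ t → V' (y t) (f (y t)) = 0 := by
    intro t ht
    have h1 := hy.hasDerivWithinAt_comp hV ht
    have h2 : HasDerivWithinAt (fun s => V (y s)) 0 (Set.Ici 0) t :=
      (hasDerivWithinAt_const t (Set.Ici (0 : ℝ)) l).congr (fun s hs => hconst s hs) (hconst t ht)
    exact (uniqueDiffOn_Ici (0 : ℝ) t ht).eq_deriv _ h1 h2
  have hxx : x = x₀ := hy0.symm.trans (hinv y hy hzero)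
  have : c ≤ l := ge_of_tendsto' (hlt 0 le_rfl) fun n => hge _ (by positivity)
  rw [← hVx, hxx] at this
  exact absurd hc this.not_gt

/-- LaSalle's invariance principle for a proper strict-minimum Lyapunov function. -/
theorem isGAS_of_lyapunov {f : E → E} (hf : LocallyLipschitz f) {V : E → ℝ}
    {V' : E → E →L[ℝ] ℝ} (hV : ∀ x, HasFDerivAt V (V' x) x) (hdec : ∀ x, V' x (f x) ≤ 0)
    (hcomp : ∀ c, IsCompact {x | V x ≤ c}) {x₀ : E} (hpos : ∀ x, x ≠ x₀ → V x₀ < V x)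
    (hf0 : f x₀ = 0)
    (hinv : ∀ y, IsSol f (Set.Ici 0) y → (∀ t, 0 ≤ t → V' (y t) (f (y t)) = 0) → y 0 = x₀) :
    IsGAS (IsSol f) x₀ := by
  have hVc : Continuous V := continuous_iff_continuousAt.2 fun x => (hV x).continuousAt
  -- Small strict sublevel sets lie in `U`: on the compact part of `{V ≤ V x₀ + 1}` outside
  -- `interior U`, the minimum of `V` exceeds `V x₀`.
  have hstab : ∀ U ∈ 𝓝 x₀, ∃ c, V x₀ < c ∧ {x | V x < c} ⊆ U := by
    intro U hU
    have hK : IsCompact ({x | V x ≤ V x₀ + 1} \ interior U) := (hcomp _).diff isOpen_interior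
    have hx₀ : x₀ ∈ interior U := mem_interior_iff_mem_nhds.2 hU
    rcases Set.eq_empty_or_nonempty ({x | V x ≤ V x₀ + 1} \ interior U) with h | h
    · refine ⟨V x₀ + 1, by linarith, fun x hx => ?_⟩
      by_contra hxU
      have : x ∈ ({x | V x ≤ V x₀ + 1} \ interior U) :=
        ⟨le_of_lt (show V x < _ from hx), fun h => hxU (interior_subset h)⟩
      rw [h] at this
      exact this
    · obtain ⟨m, hm, hmin⟩ := hK.exists_isMinOn h hVc.continuousOn
      refine ⟨min (V x₀ + 1) (V m), lt_min (by linarith)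
        (hpos m fun h => hm.2 (h ▸ hx₀)), fun x hx => ?_⟩
      have hx' := lt_min_iff.1 (show V x < _ from hx)
      by_contra hxU
      exact hx'.2.not_ge (hmin ⟨hx'.1.le, fun h => hxU (interior_subset h)⟩)
  refine ⟨fun t _ => ?_, exists_isSol_of_lyapunov hf hV hdec hcomp, fun T z z' hz hz' h0 =>
    hz.eqOn hf hz' h0, fun U hU => ?_, fun z hz => ?_⟩
  · simpa [hf0] using hasDerivWithinAt_const t (Set.Ici (0 : ℝ)) x₀
  · obtain ⟨c, hc, hcU⟩ := hstab U hU
    exact ⟨{x | V x < c}, (isOpen_lt hVc continuous_const).mem_nhds hc, fun z hz hz0 t ht =>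
      hcU (lt_of_le_of_lt (hz.antitoneOn hV hdec Set.self_mem_Ici ht ht) hz0)⟩
  · rw [tendsto_def]
    intro U hU
    obtain ⟨c, hc, hcU⟩ := hstab U hU
    obtain ⟨t, ht, htc⟩ := hz.exists_lt_of_lyapunov hf hV hdec hcomp hinv hc
    filter_upwards [eventually_ge_atTop t] with s hs
    exact hcU (lt_of_le_of_lt (hz.antitoneOn hV hdec ht (ht.trans hs) hs) htc)

end Lyapunov

/-! ### Smooth families of bounded continuous functions of the abscissa -/

section SmoothFamily

open scoped ContDiff BoundedContinuousFunction

variable {P Q W W' : Type*} [NormedAddCommGroup P] [NormedSpace ℝ P]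
  [NormedAddCommGroup Q] [NormedSpace ℝ Q] [NormedAddCommGroup W] [NormedSpace ℝ W]
  [NormedAddCommGroup W'] [NormedSpace ℝ W']

/-- `f p X` depends smoothly on `p`, uniformly in `X`: `p ↦ f p` is a smooth map into the space of
bounded continuous functions. -/
def SmoothFamily (f : P → ℝ → W) : Prop :=
  ∃ F : P → (ℝ →ᵇ W), ContDiff ℝ ∞ F ∧ ∀ p X, F p X = f p X

namespace SmoothFamily

theorem continuous {f : P → ℝ → W} (hf : SmoothFamily f) (p : P) : Continuous (f p) := by
  obtain ⟨F, -, hF⟩ := hf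
  exact (F p).continuous.congr (hF p)

theorem of_bounded {h : ℝ → W} (hc : Continuous h) {C : ℝ} (hC : ∀ X, ‖h X‖ ≤ C) :
    SmoothFamily fun (_ : P) X => h X :=
  ⟨fun _ => BoundedContinuousFunction.ofNormedAddCommGroup h hc C hC, contDiff_const,
    fun _ _ => rfl⟩

theorem of_const (c : W) : SmoothFamily fun (_ : P) (_ : ℝ) => c :=
  of_bounded continuous_const (C := ‖c‖) fun _ => le_rfl

theorem of_contDiff {g : P → ℝ} (hg : ContDiff ℝ ∞ g) : SmoothFamily fun p (_ : ℝ) => g p :=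
  ⟨fun p => g p • (1 : ℝ →ᵇ ℝ), hg.smul contDiff_const, fun p X => by simp⟩

theorem comp {f : P → ℝ → W} (hf : SmoothFamily f) {g : Q → P} (hg : ContDiff ℝ ∞ g) :
    SmoothFamily fun p => f (g p) := by
  obtain ⟨F, hF, hFf⟩ := hf
  exact ⟨fun p => F (g p), hF.comp hg, fun p => hFf (g p)⟩

theorem add {f g : P → ℝ → W} (hf : SmoothFamily f) (hg : SmoothFamily g) :
    SmoothFamily fun p X => f p X + g p X := by
  obtain ⟨F, hF, hFf⟩ := hf
  obtain ⟨G, hG, hGg⟩ := hg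
  exact ⟨fun p => F p + G p, hF.add hG, fun p X => by simp [hFf, hGg]⟩

theorem neg {f : P → ℝ → W} (hf : SmoothFamily f) : SmoothFamily fun p X => -f p X := by
  obtain ⟨F, hF, hFf⟩ := hf
  exact ⟨fun p => -F p, hF.neg, fun p X => by simp [hFf]⟩

theorem sum {ι : Type*} (s : Finset ι) {f : ι → P → ℝ → W} (hf : ∀ i, SmoothFamily (f i)) :
    SmoothFamily fun p X => ∑ i ∈ s, f i p X := by
  choose F hF hFf using hf
  exact ⟨fun p => ∑ i ∈ s, F i p, ContDiff.sum fun i _ => hF i, fun p X => by simp [hFf]⟩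

theorem mul {R : Type*} [NormedRing R] [NormedAlgebra ℝ R] {f g : P → ℝ → R}
    (hf : SmoothFamily f) (hg : SmoothFamily g) : SmoothFamily fun p X => f p X * g p X := by
  obtain ⟨F, hF, hFf⟩ := hf
  obtain ⟨G, hG, hGg⟩ := hg
  exact ⟨fun p => F p * G p, hF.mul hG, fun p X => by simp [hFf, hGg]⟩

theorem clm {f : P → ℝ → W} (hf : SmoothFamily f) (T : W →L[ℝ] W') :
    SmoothFamily fun p X => T (f p X) := by
  obtain ⟨F, hF, hFf⟩ := hf
  exact ⟨fun p => T.compLeftContinuousBounded ℝ (F p),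
    (T.compLeftContinuousBounded ℝ).contDiff.comp hF, fun p X => by simp [hFf]⟩

/-- The exponential of the Banach algebra of bounded continuous functions is analytic, and
evaluation at `X` is a continuous ring homomorphism, so it commutes with the exponential. -/
theorem exp {R : Type*} [NormedRing R] [NormedAlgebra ℝ R] [CompleteSpace R] {f : P → ℝ → R}
    (hf : SmoothFamily f) : SmoothFamily fun p X => NormedSpace.exp (f p X) := by
  obtain ⟨F, hF, hFf⟩ := hf
  have hexp : ContDiff ℝ ∞ (NormedSpace.exp : (ℝ →ᵇ R) → (ℝ →ᵇ R)) :=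
    contDiff_iff_contDiffAt.2 fun x => (NormedSpace.exp_analytic (𝕂 := ℝ) x).contDiffAt
  refine ⟨fun p => NormedSpace.exp (F p), hexp.comp hF, fun p X => ?_⟩
  let ev : (ℝ →ᵇ R) →+* R :=
    { toFun := fun f => f X
      map_one' := rfl
      map_mul' := fun _ _ => rfl
      map_zero' := rfl
      map_add' := fun _ _ => rfl }
  let _ : NormedAlgebra ℚ (ℝ →ᵇ R) := NormedAlgebra.restrictScalars ℚ ℝ (ℝ →ᵇ R)
  let _ : Algebra ℚ R := Algebra.compHom R (algebraMap ℚ ℝ)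
  have := NormedSpace.map_exp ev (BoundedContinuousFunction.evalCLM ℝ X).continuous (F p)
  exact this.trans (congrArg _ (hFf p X))

/-- Since `h` is bounded, `φ ↦ ∫ s in a..(a + h X), φ s` is a bounded operator of norm at most `C`
for the sup norm. -/
theorem integral {f : P → ℝ → ℝ} (hf : SmoothFamily f) (a : ℝ) {h : ℝ → ℝ} (hc : Continuous h)
    {C : ℝ} (hC : ∀ X, |h X| ≤ C) : SmoothFamily fun p X => ∫ s in a..(a + h X), f p s := by
  obtain ⟨F, hF, hFf⟩ := hf
  have hbd : ∀ (φ : ℝ →ᵇ ℝ) (X : ℝ), ‖∫ s in a..(a + h X), φ s‖ ≤ C * ‖φ‖ := by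
    intro φ X
    refine (intervalIntegral.norm_integral_le_of_norm_le_const (C := ‖φ‖)
      fun x _ => φ.norm_coe_le_norm x).trans ?_
    rw [add_sub_cancel_left, mul_comm]
    exact mul_le_mul_of_nonneg_right (hC X) (norm_nonneg _)
  let T : (ℝ →ᵇ ℝ) →ₗ[ℝ] (ℝ →ᵇ ℝ) :=
    { toFun := fun φ => BoundedContinuousFunction.ofNormedAddCommGroup
        (fun X => ∫ s in a..(a + h X), φ s)
        ((intervalIntegral.continuous_primitive
          (fun _ _ => φ.continuous.intervalIntegrable _ _) a).comp (continuous_const.add hc))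
        (C * ‖φ‖) (hbd φ)
      map_add' := fun φ ψ => by
        ext X
        exact intervalIntegral.integral_add (φ.continuous.intervalIntegrable _ _)
          (ψ.continuous.intervalIntegrable _ _)
      map_smul' := fun c φ => by
        ext X
        exact intervalIntegral.integral_smul c _ }
  have hC0 : 0 ≤ C := (abs_nonneg _).trans (hC 0)
  let T' := T.mkContinuous C fun φ =>
    BoundedContinuousFunction.norm_ofNormedAddCommGroup_le _ (by positivity) (hbd φ)
  refine ⟨fun p => T' (F p), T'.contDiff.comp hF, fun p X => ?_⟩
  change ∫ s in a..(a + h X), F p s = _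
  simp [hFf]

theorem hasDerivAt_line {F : P → (ℝ →ᵇ ℝ)} (hF : ContDiff ℝ ∞ F)
    (p v : P) : HasDerivAt (fun t : ℝ => F (p + t • v)) (fderiv ℝ F p v) 0 := by
  have h1 : HasDerivAt (fun t : ℝ => p + t • v) v 0 := by
    simpa using ((hasDerivAt_id (0 : ℝ)).smul_const v).const_add p
  have h2 : HasFDerivAt F (fderiv ℝ F p) (p + (0 : ℝ) • v) := by
    simpa using (hF.differentiable (by simp) p).hasFDerivAt
  exact h2.comp_hasDerivAt 0 h1

theorem hasDerivAt_line_apply {F : P → (ℝ →ᵇ ℝ)} (hF : ContDiff ℝ ∞ F)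
    (p v : P) (X : ℝ) : HasDerivAt (fun t : ℝ => F (p + t • v) X) (fderiv ℝ F p v X) 0 :=
  (BoundedContinuousFunction.evalCLM (β := ℝ) ℝ X).hasFDerivAt.comp_hasDerivAt (0 : ℝ)
    (hasDerivAt_line hF p v)

theorem hasDerivAt {f : P → ℝ → ℝ} (hf : SmoothFamily f) (p v : P) (X : ℝ) :
    HasDerivAt (fun t : ℝ => f (p + t • v) X) (deriv (fun t : ℝ => f (p + t • v) X) 0) 0 := by
  obtain ⟨F, hF, hFf⟩ := hf
  have h := hasDerivAt_line_apply hF p v X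
  simp only [hFf] at h
  exact h.differentiableAt.hasDerivAt

/-- The derivative along a line is `fderiv ℝ F q v`, jointly smooth in `(q, v)`. This is what makes
`jacDot` a smooth family. -/
theorem deriv {f : P → ℝ → ℝ} (hf : SmoothFamily f) :
    SmoothFamily fun (p : P × P) X => deriv (fun t : ℝ => f (p.1 + t • p.2) X) 0 := by
  obtain ⟨F, hF, hFf⟩ := hf
  refine ⟨fun p => fderiv ℝ F p.1 p.2, ?_, fun p X => ?_⟩
  · exact ((hF.fderiv_right (m := ∞) (by simp)).comp contDiff_fst).clm_apply contDiff_snd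
  · have h := hasDerivAt_line_apply hF p.1 p.2 X
    simp only [hFf] at h
    exact h.deriv.symm

/-- Integration against an integrable weight, as a linear map. -/
def weightLinear (L : ℝ) (w : ℝ → ℝ) (hw : IntervalIntegrable w volume 0 L) :
    (ℝ →ᵇ ℝ) →ₗ[ℝ] ℝ where
  toFun φ := ∫ X in 0..L, w X * φ X
  map_add' φ ψ := by
    simp only [BoundedContinuousFunction.coe_add, Pi.add_apply, mul_add]
    exact intervalIntegral.integral_add (hw.mul_continuousOn φ.continuous.continuousOn)
      (hw.mul_continuousOn ψ.continuous.continuousOn)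
  map_smul' c φ := by
    simp only [BoundedContinuousFunction.coe_smul, smul_eq_mul, RingHom.id_apply]
    rw [← intervalIntegral.integral_const_mul]
    exact intervalIntegral.integral_congr fun X _ => by ring

theorem exists_weightCLM {L : ℝ} {w : ℝ → ℝ} (hw : IntervalIntegrable w volume 0 L) :
    ∃ T : (ℝ →ᵇ ℝ) →L[ℝ] ℝ, ∀ φ, T φ = ∫ X in 0..L, w X * φ X := by
  refine ⟨(weightLinear L w hw).mkContinuous (abs (∫ X in 0..L, |w X|)) fun φ => ?_, fun φ => rfl⟩
  have h : ∀ X, ‖w X * φ X‖ ≤ ‖φ‖ * |w X| := fun X => by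
    rw [norm_mul, mul_comm, Real.norm_eq_abs (w X)]
    exact mul_le_mul_of_nonneg_right (φ.norm_coe_le_norm X) (abs_nonneg _)
  have := intervalIntegral.norm_integral_le_abs_of_norm_le (a := 0) (b := L) (μ := volume)
    (f := fun X => w X * φ X) (.of_forall h) (hw.abs.const_mul ‖φ‖)
  rwa [intervalIntegral.integral_const_mul, abs_mul, abs_norm, mul_comm] at this

theorem contDiff_weight {f : P → ℝ → ℝ} (hf : SmoothFamily f) {L : ℝ} {w : ℝ → ℝ}
    (hw : IntervalIntegrable w volume 0 L) : ContDiff ℝ ∞ fun p => ∫ X in 0..L, w X * f p X := by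
  obtain ⟨F, hF, hFf⟩ := hf
  obtain ⟨T, hT⟩ := exists_weightCLM hw
  simpa only [Function.comp_def, hT, hFf] using T.contDiff.comp hF

/-- Differentiation under the integral sign is here the chain rule for a continuous linear
functional. -/
theorem hasDerivAt_weight {f : P → ℝ → ℝ} (hf : SmoothFamily f) {L : ℝ} {w : ℝ → ℝ}
    (hw : IntervalIntegrable w volume 0 L) (p v : P) :
    HasDerivAt (fun t : ℝ => ∫ X in 0..L, w X * f (p + t • v) X)
      (∫ X in 0..L, w X * _root_.deriv (fun t : ℝ => f (p + t • v) X) 0) 0 := by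
  obtain ⟨F, hF, hFf⟩ := hf
  obtain ⟨T, hT⟩ := exists_weightCLM hw
  have h := T.hasFDerivAt.comp_hasDerivAt (0 : ℝ) (hasDerivAt_line hF p v)
  have hd : ∀ X, _root_.deriv (fun t : ℝ => f (p + t • v) X) 0 = fderiv ℝ F p v X := by
    intro X
    have h := hasDerivAt_line_apply hF p v X
    simp only [hFf] at h
    exact h.deriv
  simp only [hd]
  simpa only [Function.comp_def, hT, hFf] using h

/-- Integrals involving the norm of a smooth family are locally Lipschitz in the parameter. -/
theorem locallyLipschitz_weight_norm {f : P → ℝ → ℝ} (hf : SmoothFamily f) {g : P → ℝ → W}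
    (hg : SmoothFamily g) {L : ℝ} {w : ℝ → ℝ} (hw : IntervalIntegrable w volume 0 L) :
    LocallyLipschitz fun p => ∫ X in 0..L, w X * (‖g p X‖ * f p X) := by
  obtain ⟨F, hF, hFf⟩ := hf
  obtain ⟨G, hG, hGg⟩ := hg
  obtain ⟨T, hT⟩ := exists_weightCLM hw
  -- The norm is not differentiable at `0`, but composing with it is 1-Lipschitz for the sup norm.
  have hG' : LocallyLipschitz fun p => (G p).comp (fun x : W => ‖x‖) lipschitzWith_one_norm :=
    (BoundedContinuousFunction.lipschitz_comp lipschitzWith_one_norm).locallyLipschitz.comp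
      (hG.of_le (by simp)).locallyLipschitz
  have hm : ContDiff ℝ 1 fun x : (ℝ →ᵇ ℝ) × (ℝ →ᵇ ℝ) => T (x.1 * x.2) :=
    T.contDiff.comp (contDiff_fst.mul contDiff_snd)
  have := hm.locallyLipschitz.comp (hG'.prodMk (hF.of_le (by simp)).locallyLipschitz)
  simpa [Function.comp_def, hT, hFf, hGg] using this

end SmoothFamily

end SmoothFamily

/-! ### The pose and the Jacobian as smooth families -/

section Pose

open scoped ContDiff

attribute [local instance] Matrix.linftyOpNormedRing Matrix.linftyOpNormedAlgebra

variable {P : Type*} [NormedAddCommGroup P] [NormedSpace ℝ P]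

theorem SmoothFamily.entry {n : Type*} [Fintype n] [DecidableEq n] {f : P → ℝ → Matrix n n ℝ}
    (hf : SmoothFamily f) (i j : n) : SmoothFamily fun p X => f p X i j :=
  hf.clm (LinearMap.toContinuousLinearMap (Matrix.entryLinearMap ℝ ℝ i j))

theorem SmoothFamily.of_entries {n : Type*} [Fintype n] [DecidableEq n]
    {f : P → ℝ → Matrix n n ℝ} (hf : ∀ i j, SmoothFamily fun p X => f p X i j) :
    SmoothFamily f := by
  have h : f = fun p X => ∑ i, ∑ j, f p X i j • Matrix.single i j (1 : ℝ) := by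
    funext p X
    conv_lhs => rw [Matrix.matrix_eq_sum_single (f p X)]
    simp
  rw [h]
  exact SmoothFamily.sum _ fun i => SmoothFamily.sum _ fun j =>
    (hf i j).clm (ContinuousLinearMap.toSpanSingleton ℝ (Matrix.single i j (1 : ℝ)))

theorem SmoothFamily.hat {w : P → ℝ → Fin 3 → ℝ} (hw : ∀ k, SmoothFamily fun p X => w p X k)
    (i j : Fin 3) : SmoothFamily fun p X => hat (w p X) i j := by
  fin_cases i <;> fin_cases j <;>
    simp [PCS.hat, SmoothFamily.of_const, hw, (hw _).neg]

/-- Only the zeroth term of the exponential series survives. Applied to the zero last row of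
`toSE3`, it gives the last row of the inverse poses. -/
theorem vecMul_exp_of_vecMul_eq_zero {n : Type*} [Fintype n] [DecidableEq n]
    {Y : Matrix n n ℝ} {r : n → ℝ} (h : r ᵥ* Y = 0) : r ᵥ* NormedSpace.exp Y = r := by
  have : CompleteSpace (Matrix n n ℝ) := FiniteDimensional.complete ℝ _
  let T : Matrix n n ℝ →L[ℝ] (n → ℝ) := LinearMap.toContinuousLinearMap
    { toFun := fun m => r ᵥ* m
      map_add' := fun a b => Matrix.vecMul_add a b r
      map_smul' := fun c a => by simp [Matrix.vecMul_smul] }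
  have h1 := (NormedSpace.exp_series_hasSum_exp' (𝕂 := ℝ) Y).mapL T
  have h2 : HasSum (fun n => T (((n.factorial : ℝ))⁻¹ • Y ^ n)) r := by
    convert hasSum_single (f := fun n => T (((n.factorial : ℝ))⁻¹ • Y ^ n)) 0 fun n hn => ?_
    · change r = r ᵥ* (((Nat.factorial 0 : ℝ))⁻¹ • Y ^ 0)
      simp
    · obtain ⟨m, rfl⟩ := Nat.exists_eq_succ_of_ne_zero hn
      change r ᵥ* (((m.succ.factorial : ℝ))⁻¹ • Y ^ (m + 1)) = 0
      rw [Matrix.vecMul_smul, pow_succ', ← Matrix.vecMul_vecMul, h, Matrix.zero_vecMul, smul_zero]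
  exact h1.unique h2

theorem single_vecMul_smul_toSE3 (c : ℝ) (x : Screw) :
    (Pi.single (Sum.inr ()) (1 : ℝ) : Fin 3 ⊕ Unit → ℝ) ᵥ* (c • toSE3 x) = 0 := by
  rw [Matrix.single_one_vecMul]
  funext j
  rcases j with j | j <;> simp [toSE3]

namespace Arm

variable {N : ℕ} (A : Arm N)

theorem continuous_part (i : Fin N) : Continuous (A.part i) := by
  unfold part
  fun_prop

theorem part_nonneg (i : Fin N) (X : ℝ) : 0 ≤ A.part i X := le_max_left _ _

theorem abs_part_le (i : Fin N) (X : ℝ) : |A.part i X| ≤ A.len i := by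
  rw [abs_of_nonneg (A.part_nonneg i X)]
  exact max_le (A.len_pos i).le (min_le_left _ _)

theorem smoothFamily_part_smul (i : Fin N) :
    SmoothFamily fun (q : Joint N) X => A.part i X • toSE3 fun a => q (i, a) := by
  have hp : SmoothFamily fun (_ : Joint N) X => A.part i X :=
    SmoothFamily.of_bounded (A.continuous_part i) (A.abs_part_le i)
  have hq : ∀ a, SmoothFamily fun (q : Joint N) (_ : ℝ) => q (i, a) := fun a =>
    SmoothFamily.of_contDiff (by fun_prop)
  refine SmoothFamily.of_entries fun r s => ?_
  have hent : SmoothFamily fun (q : Joint N) (_ : ℝ) => toSE3 (fun a => q (i, a)) r s := by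
    rcases r with r | r <;> rcases s with s | s <;>
      simp only [toSE3, Matrix.fromBlocks_apply₁₁, Matrix.fromBlocks_apply₁₂,
        Matrix.fromBlocks_apply₂₁, Matrix.fromBlocks_apply₂₂, Matrix.replicateCol_apply,
        Matrix.zero_apply]
    · exact SmoothFamily.hat (w := fun (q : Joint N) _ => ang fun a => q (i, a)) (fun k => hq (Sum.inl k)) r s
    · exact hq (Sum.inr r)
    · exact SmoothFamily.of_const 0
    · exact SmoothFamily.of_const 0
  simpa using hp.mul hent

/-- The right inverse `G` is the product of the inverse exponentials in reverse order. Its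
smoothness and its last row are carried through the same induction. -/
theorem smoothFamily_list_prod_exp (l : List (Fin N)) :
    (SmoothFamily fun (q : Joint N) X =>
      (l.map fun i => NormedSpace.exp (A.part i X • toSE3 fun a => q (i, a))).prod) ∧
    ∃ G : Joint N → ℝ → Hom, SmoothFamily G ∧ ∀ q X,
      (l.map fun i => NormedSpace.exp (A.part i X • toSE3 fun a => q (i, a))).prod * G q X = 1 ∧
      (Pi.single (Sum.inr ()) (1 : ℝ) : Fin 3 ⊕ Unit → ℝ) ᵥ* G q X =
        Pi.single (Sum.inr ()) (1 : ℝ) := by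
  have : CompleteSpace Hom := FiniteDimensional.complete ℝ _
  induction l with
  | nil => exact ⟨by simpa using SmoothFamily.of_const (1 : Hom), fun _ _ => 1,
      SmoothFamily.of_const (1 : Hom), by simp⟩
  | cons i l ih =>
    obtain ⟨hl, G, hG, h⟩ := ih
    have hY := A.smoothFamily_part_smul i
    refine ⟨?_, fun q X => G q X * NormedSpace.exp (-(A.part i X • toSE3 fun a => q (i, a))),
      hG.mul hY.neg.exp, fun q X => ⟨?_, ?_⟩⟩
    · simp only [List.map_cons, List.prod_cons]
      exact hY.exp.mul hl
    · rw [List.map_cons, List.prod_cons, mul_assoc, ← mul_assoc _ (G q X), (h q X).1, one_mul]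
      have hc : Commute (A.part i X • toSE3 fun a => q (i, a))
          (-(A.part i X • toSE3 fun a => q (i, a))) := (Commute.refl _).neg_right
      rw [← Matrix.exp_add_of_commute _ _ hc, add_neg_cancel,
        NormedSpace.exp_zero]
    · rw [← Matrix.vecMul_vecMul, (h q X).2, ← neg_smul]
      exact vecMul_exp_of_vecMul_eq_zero (single_vecMul_smul_toSE3 _ _)

theorem pose_eq_map_finRange (q : Joint N) (X : ℝ) : A.pose q X =
    ((List.finRange N).map fun i =>
      NormedSpace.exp (A.part i X • toSE3 fun a => q (i, a))).prod := by
  rw [pose, List.ofFn_eq_map]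

theorem smoothFamily_pose : SmoothFamily A.pose := by
  have := (A.smoothFamily_list_prod_exp (List.finRange N)).1
  simpa only [← pose_eq_map_finRange] using this

theorem smoothFamily_pose_apply (r s : Fin 3 ⊕ Unit) :
    SmoothFamily fun (q : Joint N) X => A.pose q X r s := A.smoothFamily_pose.entry r s

/-- As the last row of `G` is `(0, 1)`, the upper left block of `pose * G = 1` reads `rot pose * rot
G = 1`. Orthogonality of rotations is not required. -/
theorem exists_smoothFamily_rot_inv : ∃ R' : Joint N → ℝ → Matrix (Fin 3) (Fin 3) ℝ,
    (∀ i j, SmoothFamily fun q X => R' q X i j) ∧ ∀ q X, rot (A.pose q X) * R' q X = 1 := by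
  obtain ⟨-, G, hG, h⟩ := A.smoothFamily_list_prod_exp (List.finRange N)
  refine ⟨fun q X => rot (G q X), fun i j => hG.entry (Sum.inl i) (Sum.inl j), fun q X => ?_⟩
  obtain ⟨h1, h2⟩ := h q X
  rw [← pose_eq_map_finRange] at h1
  rw [Matrix.single_one_vecMul] at h2
  ext i j
  have h3 := congrFun₂ h1 (Sum.inl i) (Sum.inl j)
  have h4 : G q X (Sum.inr ()) (Sum.inl j) = 0 := by simpa using! congrFun h2 (Sum.inl j)
  rw [Matrix.mul_apply, Fintype.sum_sum_type] at h3
  simp only [Finset.univ_unique, Finset.sum_singleton] at h3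
  rw [show (default : Unit) = () from rfl, h4, mul_zero, add_zero] at h3
  simpa [Matrix.mul_apply, rot, Matrix.toBlocks₁₁, Matrix.one_apply] using h3

/-- An explicit inverse of `Ad g`, polynomial in `R'` and in the position, hence smooth along the
poses. -/
theorem Ad_mul_of_rot_mul {g : Hom} {R' : Matrix (Fin 3) (Fin 3) ℝ} (h : rot g * R' = 1) :
    Ad g * Matrix.fromBlocks R' 0 (-(R' * hat (pos g))) R' = 1 := by
  rw [Ad, Matrix.fromBlocks_multiply]
  simp only [Matrix.zero_mul, Matrix.mul_zero, add_zero, zero_add, Matrix.mul_neg]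
  rw [Matrix.mul_assoc, h, ← Matrix.mul_assoc, h]
  simp

theorem Ad_pose_mul_inv (q : Joint N) (X : ℝ) : Ad (A.pose q X) * (Ad (A.pose q X))⁻¹ = 1 := by
  obtain ⟨R', -, h⟩ := A.exists_smoothFamily_rot_inv
  rw [Matrix.inv_eq_right_inv (Ad_mul_of_rot_mul (h q X))]
  exact Ad_mul_of_rot_mul (h q X)

theorem Ad_pose_inv_mul (q : Joint N) (X : ℝ) : (Ad (A.pose q X))⁻¹ * Ad (A.pose q X) = 1 :=
  mul_eq_one_comm.1 (A.Ad_pose_mul_inv q X)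

theorem smoothFamily_Ad (a b : Idx) : SmoothFamily fun (q : Joint N) X => Ad (A.pose q X) a b := by
  have hR : ∀ i j, SmoothFamily fun (q : Joint N) X => rot (A.pose q X) i j := fun i j =>
    A.smoothFamily_pose_apply (Sum.inl i) (Sum.inl j)
  have hp : ∀ i j, SmoothFamily fun (q : Joint N) X => hat (pos (A.pose q X)) i j :=
    SmoothFamily.hat fun k => A.smoothFamily_pose_apply (Sum.inl k) (Sum.inr ())
  rcases a with a | a <;> rcases b with b | b <;>
    simp only [Ad, Matrix.fromBlocks_apply₁₁, Matrix.fromBlocks_apply₁₂,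
      Matrix.fromBlocks_apply₂₁, Matrix.fromBlocks_apply₂₂, Matrix.mul_apply, Matrix.zero_apply]
  · exact hR a b
  · exact SmoothFamily.of_const 0
  · exact SmoothFamily.sum _ fun k => (hp a k).mul (hR k b)
  · exact hR a b

theorem smoothFamily_Ad_inv (a b : Idx) :
    SmoothFamily fun (q : Joint N) X => (Ad (A.pose q X))⁻¹ a b := by
  obtain ⟨R', hR, h⟩ := A.exists_smoothFamily_rot_inv
  have hp : ∀ i j, SmoothFamily fun (q : Joint N) X => hat (pos (A.pose q X)) i j :=
    SmoothFamily.hat fun k => A.smoothFamily_pose_apply (Sum.inl k) (Sum.inr ())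
  simp only [fun q X => Matrix.inv_eq_right_inv (Ad_mul_of_rot_mul (h q X))]
  rcases a with a | a <;> rcases b with b | b <;>
    simp only [Matrix.fromBlocks_apply₁₁, Matrix.fromBlocks_apply₁₂,
      Matrix.fromBlocks_apply₂₁, Matrix.fromBlocks_apply₂₂, Matrix.mul_apply, Matrix.zero_apply,
      Matrix.neg_apply]
  · exact hR a b
  · exact SmoothFamily.of_const 0
  · exact (SmoothFamily.sum _ fun k => (hR a k).mul (hp k b)).neg
  · exact hR a b

theorem smoothFamily_jac (a : Idx) (i : Fin N × Idx) :
    SmoothFamily fun (q : Joint N) X => A.jac q X a i := by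
  simp only [jac, Matrix.of_apply, Matrix.mul_apply, matInt]
  exact SmoothFamily.sum _ fun c => (A.smoothFamily_Ad_inv a c).mul
    ((A.smoothFamily_Ad c i.2).integral _ (A.continuous_part i.1) (A.abs_part_le i.1))

theorem smoothFamily_jacDot (a : Idx) (i : Fin N × Idx) :
    SmoothFamily fun (x : Joint N × Joint N) X => A.jacDot x.1 x.2 X a i :=
  (A.smoothFamily_jac a i).deriv

/-! #### Injectivity of the Jacobian -/

theorem Ad_mulVec_jac_mulVec (q v : Joint N) (X : ℝ) (a : Idx) :
    (Ad (A.pose q X) *ᵥ (A.jac q X *ᵥ v)) a = ∑ i, ∫ s in A.start i..(A.start i + A.part i X),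
      (Ad (A.pose q s) *ᵥ fun b => v (i, b)) a := by
  have h1 : A.jac q X *ᵥ v = (Ad (A.pose q X))⁻¹ *ᵥ ∑ i,
      matInt (A.start i) (A.start i + A.part i X) (fun s => Ad (A.pose q s)) *ᵥ
        fun b => v (i, b) := by
    rw [Matrix.mulVec_sum]
    funext c
    rw [Finset.sum_apply, Matrix.mulVec, dotProduct, Fintype.sum_prod_type]
    refine Finset.sum_congr rfl fun i _ => ?_
    rw [Matrix.mulVec_mulVec]
    rfl
  rw [h1, Matrix.mulVec_mulVec, A.Ad_pose_mul_inv, Matrix.one_mulVec, Finset.sum_apply]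
  refine Finset.sum_congr rfl fun i _ => ?_
  simp only [Matrix.mulVec, dotProduct, matInt, Matrix.of_apply]
  refine Eq.trans ?_ (intervalIntegral.integral_finsetSum
    (f := fun b s => Ad (A.pose q s) a b * v (i, b)) fun b _ =>
    (((A.smoothFamily_Ad a b).continuous q).mul continuous_const).intervalIntegrable _ _).symm
  exact Finset.sum_congr rfl fun b _ => (intervalIntegral.integral_mul_const _ _).symm

theorem start_nonneg (i : Fin N) : 0 ≤ A.start i := Finset.sum_nonneg fun j _ => (A.len_pos j).le

theorem start_add_len (i : Fin N) : A.start i + A.len i = ∑ j ∈ Finset.Iic i, A.len j := by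
  rw [start, ← Finset.Iio_insert, Finset.sum_insert (by simp), add_comm]

theorem start_add_len_le_total (i : Fin N) : A.start i + A.len i ≤ A.total := by
  rw [start_add_len]
  exact Finset.sum_le_sum_of_subset_of_nonneg (Finset.subset_univ _) fun j _ _ => (A.len_pos j).le

theorem start_add_len_le_start {i j : Fin N} (h : i < j) : A.start i + A.len i ≤ A.start j := by
  rw [start_add_len]
  exact Finset.sum_le_sum_of_subset_of_nonneg
    (fun k hk => Finset.mem_Iio.2 ((Finset.mem_Iic.1 hk).trans_lt h)) fun j _ _ => (A.len_pos j).le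

theorem part_start_add_self (i : Fin N) {h : ℝ} (h0 : 0 ≤ h) (hl : h ≤ A.len i) :
    A.part i (A.start i + h) = h := by
  rw [part, add_sub_cancel_left, min_eq_right hl, max_eq_right h0]

theorem part_start_add_of_ne {i j : Fin N} (hij : j ≠ i) {h : ℝ} (h0 : 0 ≤ h)
    (hl : h ≤ A.len i) : A.part j (A.start i + h) = A.part j (A.start i) := by
  rcases lt_or_gt_of_ne hij with hlt | hgt
  · have := A.start_add_len_le_start hlt
    rw [part, part, min_eq_left (by linarith), min_eq_left (by linarith)]
  · have := A.start_add_len_le_start hgt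
    rw [part, part, max_eq_left (min_le_of_right_le (by linarith)),
      max_eq_left (min_le_of_right_le (by linarith [A.len_pos i]))]

/-- While `X` runs through section `i`, only the `i`-th integral in `Ad_mulVec_jac_mulVec` varies.
Its derivative at the start of the section is `Ad` of the pose applied to the block `v_i`, and `Ad`
is invertible. -/
theorem eq_zero_of_jac_mulVec_eq_zero {q v : Joint N}
    (h : ∀ X ∈ Set.Icc 0 A.total, A.jac q X *ᵥ v = 0) : v = 0 := by
  have key : ∀ i, (fun b => v (i, b)) = (0 : Screw) := by
    intro i
    suffices h0 : Ad (A.pose q (A.start i)) *ᵥ (fun b => v (i, b)) = 0 by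
      rw [← Matrix.one_mulVec fun b => v (i, b), ← A.Ad_pose_inv_mul q (A.start i),
        ← Matrix.mulVec_mulVec, h0, Matrix.mulVec_zero]
    funext a
    set H : Fin N → ℝ → ℝ := fun j s => (Ad (A.pose q s) *ᵥ fun b => v (j, b)) a with hH
    have hcont : ∀ j, Continuous (H j) := fun j => by
      simp only [hH, Matrix.mulVec, dotProduct]
      exact continuous_finsetSum _ fun b _ =>
        ((A.smoothFamily_Ad a b).continuous q).mul continuous_const
    have hsum : ∀ X ∈ Set.Icc 0 A.total,
        ∑ j, ∫ s in A.start j..(A.start j + A.part j X), H j s = 0 := fun X hX => by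
      rw [← A.Ad_mulVec_jac_mulVec, h X hX, Matrix.mulVec_zero]; rfl
    have hle := A.start_add_len_le_total i
    have h0 := A.start_nonneg i
    have hl := A.len_pos i
    have hint : ∀ t ∈ Set.Icc 0 (A.len i), ∫ s in A.start i..(A.start i + t), H i s = 0 := by
      -- Subtracting the identity at the start of the section from the one at distance `t` removes
      -- the other sections.
      intro t ht
      have e1 := hsum (A.start i + t) ⟨add_nonneg h0 ht.1, by linarith [ht.2]⟩
      have e0 := hsum (A.start i) ⟨h0, by linarith⟩
      rw [← Finset.add_sum_erase _ _ (Finset.mem_univ i)] at e0 e1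
      rw [A.part_start_add_self i ht.1 ht.2, Finset.sum_congr rfl fun j hj => by
        rw [A.part_start_add_of_ne (Finset.ne_of_mem_erase hj) ht.1 ht.2]] at e1
      have hz : A.part i (A.start i) = 0 := by
        simpa using A.part_start_add_self i le_rfl hl.le
      rw [hz, add_zero, intervalIntegral.integral_same] at e0
      linarith
    have hd : HasDerivAt (fun t => ∫ s in A.start i..(A.start i + t), H i s)
        (H i (A.start i)) 0 := by
      have h1 : HasDerivAt (fun u => ∫ s in A.start i..u, H i s) (H i (A.start i))
          (A.start i + 0) := by
        rw [add_zero]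
        exact ((hcont i).integral_hasStrictDerivAt _ _).hasDerivAt
      simpa using h1.comp_const_add (A.start i) 0
    -- The integral is known to vanish only on `[0, len i]`. A one-sided derivative at the endpoint
    -- suffices.
    have hd0 : HasDerivWithinAt (fun t => ∫ s in A.start i..(A.start i + t), H i s) 0
        (Set.Icc 0 (A.len i)) 0 :=
      (hasDerivWithinAt_const 0 _ (0 : ℝ)).congr hint (hint 0 ⟨le_rfl, hl.le⟩)
    exact (uniqueDiffOn_Icc hl 0 ⟨le_rfl, hl.le⟩).eq_deriv _ hd.hasDerivWithinAt hd0
  funext ⟨i, b⟩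
  exact congrFun (key i) b

end Arm

end Pose

/-! ### Integrals of matrix products -/

section Integrals

variable {m n : Type*}

/-- Isolates the entries of `W`, which are merely integrable along the arm, from the continuous
factors. -/
theorem transpose_mul_mul_apply (f : Matrix Idx m ℝ) (W : Matrix Idx Idx ℝ) (g : Matrix Idx n ℝ)
    (i : m) (j : n) : (fᵀ * W * g) i j = ∑ a, ∑ b, W a b * (f a i * g b j) := by
  simp only [Matrix.mul_apply, Matrix.transpose_apply, Finset.sum_mul]
  rw [Finset.sum_comm]
  exact Finset.sum_congr rfl fun a _ => Finset.sum_congr rfl fun b _ => by ring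

theorem intervalIntegrable_finsetSum {ι : Type*} (s : Finset ι) {a b : ℝ} {f : ι → ℝ → ℝ}
    (hf : ∀ i ∈ s, IntervalIntegrable (f i) volume a b) :
    IntervalIntegrable (fun X => ∑ i ∈ s, f i X) volume a b := by
  simpa only [Finset.sum_fn] using IntervalIntegrable.sum s hf

theorem intervalIntegrable_triple {L : ℝ} {W : ℝ → Matrix Idx Idx ℝ}
    (hW : ∀ a b, IntervalIntegrable (fun X => W X a b) volume 0 L) {f : ℝ → Matrix Idx m ℝ}
    {g : ℝ → Matrix Idx n ℝ} (hf : ∀ a i, Continuous fun X => f X a i)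
    (hg : ∀ a i, Continuous fun X => g X a i) (i : m) (j : n) :
    IntervalIntegrable (fun X => ((f X)ᵀ * W X * g X) i j) volume 0 L := by
  simp only [transpose_mul_mul_apply]
  exact intervalIntegrable_finsetSum _ fun a _ => intervalIntegrable_finsetSum _ fun b _ =>
    (hW a b).mul_continuousOn ((hf a i).mul (hg b j)).continuousOn

theorem integral_triple {L : ℝ} {W : ℝ → Matrix Idx Idx ℝ}
    (hW : ∀ a b, IntervalIntegrable (fun X => W X a b) volume 0 L) {f : ℝ → Matrix Idx m ℝ}
    {g : ℝ → Matrix Idx n ℝ} (hf : ∀ a i, Continuous fun X => f X a i)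
    (hg : ∀ a i, Continuous fun X => g X a i) (i : m) (j : n) :
    ∫ X in 0..L, ((f X)ᵀ * W X * g X) i j =
      ∑ a, ∑ b, ∫ X in 0..L, W X a b * (f X a i * g X b j) := by
  simp only [transpose_mul_mul_apply]
  have h : ∀ a b, IntervalIntegrable (fun X => W X a b * (f X a i * g X b j)) volume 0 L :=
    fun a b => (hW a b).mul_continuousOn ((hf a i).mul (hg b j)).continuousOn
  rw [intervalIntegral.integral_finsetSum fun a _ => intervalIntegrable_finsetSum _ fun b _ => h a b]
  exact Finset.sum_congr rfl fun a _ => intervalIntegral.integral_finsetSum fun b _ => h a b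

theorem dotProduct_matInt_mulVec [Fintype n] {L : ℝ} {B : ℝ → Matrix n n ℝ}
    (hB : ∀ i j, IntervalIntegrable (fun X => B X i j) volume 0 L) (v w : n → ℝ) :
    v ⬝ᵥ (matInt 0 L B *ᵥ w) = ∫ X in 0..L, v ⬝ᵥ (B X *ᵥ w) := by
  have h : ∀ i j, IntervalIntegrable (fun X => v i * (B X i j * w j)) volume 0 L :=
    fun i j => ((hB i j).mul_const _).const_mul _
  simp only [dotProduct, Matrix.mulVec, Finset.mul_sum, matInt, Matrix.of_apply]
  rw [intervalIntegral.integral_finsetSum fun a _ => intervalIntegrable_finsetSum _ fun b _ => h a b]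
  refine Finset.sum_congr rfl fun i _ => ?_
  rw [intervalIntegral.integral_finsetSum fun b _ => h i b]
  refine Finset.sum_congr rfl fun j _ => ?_
  rw [intervalIntegral.integral_const_mul, intervalIntegral.integral_mul_const]

theorem dotProduct_triple_mulVec [Fintype n] (f g : Matrix Idx n ℝ) (W : Matrix Idx Idx ℝ)
    (v w : n → ℝ) : v ⬝ᵥ ((fᵀ * W * g) *ᵥ w) = (f *ᵥ v) ⬝ᵥ (W *ᵥ (g *ᵥ w)) := by
  rw [← Matrix.mulVec_mulVec, ← Matrix.mulVec_mulVec, Matrix.dotProduct_mulVec,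
    Matrix.vecMul_transpose]

theorem ad_mulVec_self (x : Screw) : ad x *ᵥ x = 0 := by
  funext a
  rcases a with a | a <;> fin_cases a <;>
    simp [ad, Matrix.mulVec, dotProduct, hat, ang, lin, Fin.sum_univ_three] <;> ring

/-- The gyroscopic wrench does no work on its own twist: the pairing is `-(ad_x x) · y`. -/
theorem dotProduct_coad_mulVec (x y : Screw) : x ⬝ᵥ (coad x *ᵥ y) = 0 := by
  rw [coad, Matrix.neg_mulVec, dotProduct_neg, Matrix.dotProduct_mulVec, Matrix.vecMul_transpose,
    ad_mulVec_self, zero_dotProduct, neg_zero]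

theorem HasDerivAt.dotProduct_mulVec [Fintype n] {x y : ℝ → n → ℝ} {B : ℝ → Matrix n n ℝ}
    {x' y' : n → ℝ} {B' : Matrix n n ℝ} {t : ℝ} (hx : ∀ i, HasDerivAt (fun s => x s i) (x' i) t)
    (hy : ∀ i, HasDerivAt (fun s => y s i) (y' i) t)
    (hB : ∀ i j, HasDerivAt (fun s => B s i j) (B' i j) t) :
    HasDerivAt (fun s => x s ⬝ᵥ (B s *ᵥ y s))
      (x' ⬝ᵥ (B t *ᵥ y t) + x t ⬝ᵥ (B' *ᵥ y t) + x t ⬝ᵥ (B t *ᵥ y')) t := by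
  have h := HasDerivAt.fun_sum (u := Finset.univ) fun i _ => (hx i).fun_mul
    (HasDerivAt.fun_sum (u := Finset.univ) fun j _ => (hB i j).fun_mul (hy j))
  refine h.congr_deriv ?_
  simp only [dotProduct, Matrix.mulVec, Finset.sum_add_distrib, mul_add, add_assoc]

theorem exists_mul_sq_norm_le [Fintype n] {P : Type*} [TopologicalSpace P] {K : Set P}
    (hK : IsCompact K) {B : P → Matrix n n ℝ} (hB : ∀ i j, Continuous fun p => B p i j)
    (hpos : ∀ p ∈ K, ∀ v, v ≠ 0 → 0 < v ⬝ᵥ (B p *ᵥ v)) :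
    ∃ c > 0, ∀ p ∈ K, ∀ v, c * ‖v‖ ^ 2 ≤ v ⬝ᵥ (B p *ᵥ v) := by
  have hcont : Continuous fun x : P × (n → ℝ) => x.2 ⬝ᵥ (B x.1 *ᵥ x.2) := by
    simp only [dotProduct, Matrix.mulVec]
    refine continuous_finsetSum _ fun i _ => Continuous.mul (by fun_prop)
      (continuous_finsetSum _ fun j _ => ((hB i j).comp continuous_fst).mul (by fun_prop))
  -- The constant is a positive lower bound on the compact set `K × sphere`; homogeneity of degree
  -- two extends it to all `v`.
  obtain ⟨c, hc, h⟩ := (hK.prod (isCompact_sphere (0 : n → ℝ) 1)).exists_forall_le' (a := 0)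
    hcont.continuousOn fun x hx => hpos x.1 hx.1 x.2 (by
      have := hx.2
      rintro h0
      simp [h0] at this)
  refine ⟨c, hc, fun p hp v => ?_⟩
  rcases eq_or_ne v 0 with rfl | hv
  · simp
  have hv' : ‖v‖ ≠ 0 := norm_ne_zero_iff.2 hv
  have := h (p, ‖v‖⁻¹ • v) ⟨hp, by simp [norm_smul, hv']⟩
  simp only [Matrix.mulVec_smul, dotProduct_smul, smul_dotProduct, smul_eq_mul] at this
  have h2 := mul_le_mul_of_nonneg_right this (sq_nonneg ‖v‖)
  refine h2.trans_eq ?_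
  field_simp

theorem locallyLipschitz_pi {α n : Type*} [PseudoEMetricSpace α] [Fintype n] {f : α → n → ℝ}
    (hf : ∀ i, LocallyLipschitz fun x => f x i) : LocallyLipschitz f := by
  intro x
  choose K t ht hK using fun i => hf i x
  refine ⟨Finset.univ.sup K, ⋂ i, t i, Filter.iInter_mem.2 ht, fun y hy z hz => ?_⟩
  refine edist_pi_le_iff.2 fun i => (hK i (Set.mem_iInter.1 hy i) (Set.mem_iInter.1 hz i)).trans ?_
  gcongr
  exact Finset.le_sup (Finset.mem_univ i)

theorem LocallyLipschitz.finsetSum {α ι : Type*} [PseudoEMetricSpace α] (s : Finset ι)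
    {f : ι → α → ℝ} (hf : ∀ i, LocallyLipschitz (f i)) :
    LocallyLipschitz fun x => ∑ i ∈ s, f i x := by
  classical
  induction s using Finset.induction_on with
  | empty => simpa using LocallyLipschitz.const (0 : ℝ)
  | insert i s hi ih =>
    simp only [Finset.sum_insert hi]
    exact (hf i).add ih

end Integrals

/-! ### Inertia, Coriolis and drag matrices: sign properties and regularity -/

namespace Arm

open scoped ContDiff

variable {N : ℕ} (A : Arm N)

theorem total_nonneg : 0 ≤ A.total := Finset.sum_nonneg fun j _ => (A.len_pos j).le

theorem intervalIntegrable_massTot (a b : Idx) :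
    IntervalIntegrable (fun X => A.massTot X a b) volume 0 A.total := by
  refine IntervalIntegrable.add ?_ (A.addedMass_int a b)
  refine IntervalIntegrable.const_mul ?_ A.rho
  by_cases hab : a = b
  · subst hab
    simp only [Matrix.diagonal_apply_eq]
    rcases a with a | a
    · exact A.inertia_int a
    · exact A.area_int
  · simp only [Matrix.diagonal_apply_ne _ hab]
    exact intervalIntegrable_const

theorem massTot_transpose {X : ℝ} (hX : X ∈ Set.Icc 0 A.total) :
    (A.massTot X)ᵀ = A.massTot X := by
  have h : (A.addedMass X)ᵀ = A.addedMass X := by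
    simpa using! (A.addedMass_psd X hX).isHermitian.eq
  rw [massTot, Matrix.transpose_add, h, mass, Matrix.transpose_smul, Matrix.diagonal_transpose]

theorem massTot_pos {X : ℝ} (hX : X ∈ Set.Icc 0 A.total) {x : Screw} (hx : x ≠ 0) :
    0 < x ⬝ᵥ (A.massTot X *ᵥ x) := by
  have h1 : 0 ≤ x ⬝ᵥ (A.addedMass X *ᵥ x) := by
    simpa using (A.addedMass_psd X hX).dotProduct_mulVec_nonneg x
  have h2 : 0 < x ⬝ᵥ (A.mass X *ᵥ x) := by
    have hd : ∀ a : Idx, 0 < (Sum.elim (A.inertia X) fun _ => A.area X) a := by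
      rintro (a | a)
      · exact A.inertia_pos X hX a
      · exact A.area_pos X hX
    rw [mass, Matrix.smul_mulVec, dotProduct_smul, smul_eq_mul]
    refine mul_pos A.rho_pos ?_
    simp only [dotProduct, Matrix.mulVec_diagonal]
    obtain ⟨a, ha⟩ := Function.ne_iff.1 hx
    have hnn : ∀ b, 0 ≤ x b * ((Sum.elim (A.inertia X) fun _ => A.area X) b * x b) := fun b => by
      nlinarith [mul_nonneg (hd b).le (sq_nonneg (x b))]
    refine Finset.sum_pos' (fun b _ => hnn b) ⟨a, Finset.mem_univ _, ?_⟩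
    have := mul_pos (hd a) (sq_pos_of_ne_zero (show x a ≠ 0 from ha))
    nlinarith
  rw [massTot, Matrix.add_mulVec, dotProduct_add]
  linarith

theorem massTot_nonneg {X : ℝ} (hX : X ∈ Set.Icc 0 A.total) (x : Screw) :
    0 ≤ x ⬝ᵥ (A.massTot X *ᵥ x) := by
  rcases eq_or_ne x 0 with rfl | hx
  · simp
  · exact (A.massTot_pos hX hx).le

theorem continuous_jac (q : Joint N) (a : Idx) (i : Fin N × Idx) :
    Continuous fun X => A.jac q X a i := (A.smoothFamily_jac a i).continuous q

theorem continuous_jacDot (q v : Joint N) (a : Idx) (i : Fin N × Idx) :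
    Continuous fun X => A.jacDot q v X a i := (A.smoothFamily_jacDot a i).continuous (q, v)

theorem smoothFamily_jac_mulVec (a : Idx) :
    SmoothFamily fun (x : Joint N × Joint N) X => (A.jac x.1 X *ᵥ x.2) a :=
  SmoothFamily.sum _ fun i => ((A.smoothFamily_jac a i).comp contDiff_fst).mul
    (SmoothFamily.of_contDiff (by fun_prop))

theorem continuous_jac_mulVec (q v : Joint N) (a : Idx) :
    Continuous fun X => (A.jac q X *ᵥ v) a := (A.smoothFamily_jac_mulVec a).continuous (q, v)

/-! #### Inertia -/

theorem dotProduct_M_mulVec (q v w : Joint N) : v ⬝ᵥ (A.M q *ᵥ w) =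
    ∫ X in 0..A.total, (A.jac q X *ᵥ v) ⬝ᵥ (A.massTot X *ᵥ (A.jac q X *ᵥ w)) := by
  rw [M, dotProduct_matInt_mulVec (intervalIntegrable_triple A.intervalIntegrable_massTot
    (A.continuous_jac q) (A.continuous_jac q))]
  simp only [dotProduct_triple_mulVec]

/-- If the nonnegative integrand has zero integral, `J v` vanishes almost everywhere, hence
everywhere by continuity, and `J` is injective in this sense. -/
theorem M_pos (q : Joint N) {v : Joint N} (hv : v ≠ 0) : 0 < v ⬝ᵥ (A.M q *ᵥ v) := by
  rw [dotProduct_M_mulVec]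
  have hint : IntervalIntegrable (fun X => (A.jac q X *ᵥ v) ⬝ᵥ (A.massTot X *ᵥ (A.jac q X *ᵥ v)))
      volume 0 A.total := by
    simp only [dotProduct, Matrix.mulVec, Finset.mul_sum (s := Finset.univ (α := Idx))]
    refine intervalIntegrable_finsetSum _ fun a _ => intervalIntegrable_finsetSum _ fun b _ => ?_
    exact ((A.intervalIntegrable_massTot a b).mul_continuousOn
      (A.continuous_jac_mulVec q v b).continuousOn).continuousOn_mul
      (A.continuous_jac_mulVec q v a).continuousOn
  have hnn : 0 ≤ᵐ[volume.restrict (Set.Ioc 0 A.total)]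
      fun X => (A.jac q X *ᵥ v) ⬝ᵥ (A.massTot X *ᵥ (A.jac q X *ᵥ v)) :=
    (ae_restrict_iff' measurableSet_Ioc).2
      (.of_forall fun X hX => A.massTot_nonneg (Set.Ioc_subset_Icc_self hX) _)
  refine lt_of_le_of_ne (intervalIntegral.integral_nonneg A.total_nonneg fun X hX =>
    A.massTot_nonneg hX _) fun h0 => hv ?_
  have hae := (intervalIntegral.integral_eq_zero_iff_of_le_of_nonneg_ae A.total_nonneg hnn
    hint).1 h0.symm
  have hae' : (fun X => A.jac q X *ᵥ v) =ᵐ[volume.restrict (Set.Icc 0 A.total)]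
      fun _ => (0 : Screw) := by
    rw [← Measure.restrict_congr_set Ioc_ae_eq_Icc]
    filter_upwards [hae, ae_restrict_mem measurableSet_Ioc] with X hX hmem
    by_contra hne
    exact (A.massTot_pos (Set.Ioc_subset_Icc_self hmem) hne).ne' hX
  refine A.eq_zero_of_jac_mulVec_eq_zero (q := q) ?_
  -- Zero total length would mean that there is no section, hence no nonzero `v`.
  rcases A.total_nonneg.eq_or_lt with hT | hT
  · obtain ⟨⟨i, -⟩, -⟩ := Function.ne_iff.1 hv
    exact absurd hT (by linarith [A.start_add_len_le_total i, A.start_nonneg i, A.len_pos i])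
  · exact Measure.eqOn_Icc_of_ae_eq volume hT.ne hae'
      (continuous_pi fun a => A.continuous_jac_mulVec q v a).continuousOn continuousOn_const

theorem isUnit_M (q : Joint N) : IsUnit (A.M q) := by
  rw [← Matrix.mulVec_injective_iff_isUnit]
  intro v w h
  by_contra hne
  have := A.M_pos q (sub_ne_zero.2 hne)
  rw [Matrix.mulVec_sub, h, sub_self, dotProduct_zero] at this
  exact lt_irrefl _ this

theorem isUnit_det_M (q : Joint N) : IsUnit (A.M q).det :=
  (Matrix.isUnit_iff_isUnit_det _).1 (A.isUnit_M q)

theorem M_transpose (q : Joint N) : (A.M q)ᵀ = A.M q := by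
  ext i j
  refine intervalIntegral.integral_congr fun X hX => ?_
  rw [Set.uIcc_of_le A.total_nonneg] at hX
  rw [← Matrix.transpose_apply ((A.jac q X)ᵀ * A.massTot X * A.jac q X)]
  rw [Matrix.transpose_mul, Matrix.transpose_mul, Matrix.transpose_transpose,
    A.massTot_transpose hX, Matrix.mul_assoc]

theorem M_apply (q : Joint N) (i j : Fin N × Idx) : A.M q i j = ∑ a, ∑ b,
    ∫ X in 0..A.total, A.massTot X a b * (A.jac q X a i * A.jac q X b j) :=
  integral_triple A.intervalIntegrable_massTot (A.continuous_jac q) (A.continuous_jac q) i j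

theorem contDiff_M (i j : Fin N × Idx) : ContDiff ℝ ∞ fun q => A.M q i j := by
  simp only [M_apply]
  exact ContDiff.sum fun a _ => ContDiff.sum fun b _ =>
    ((A.smoothFamily_jac a i).mul (A.smoothFamily_jac b j)).contDiff_weight
      (A.intervalIntegrable_massTot a b)

/-- The product rule on `Jᵀ 𝓜_a J`, with `𝓜_a` symmetric and independent of `q`. It makes half the
rate of `M` and `C₂` do the same work on `v`. -/
theorem hasDerivAt_M (q v : Joint N) (i j : Fin N × Idx) :
    HasDerivAt (fun t : ℝ => A.M (q + t • v) i j) (((A.C₂ q v)ᵀ + A.C₂ q v) i j) 0 := by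
  simp only [M_apply]
  have h := HasDerivAt.fun_sum (u := Finset.univ) fun a _ =>
    HasDerivAt.fun_sum (u := Finset.univ) fun b _ =>
      ((A.smoothFamily_jac a i).mul (A.smoothFamily_jac b j)).hasDerivAt_weight
        (A.intervalIntegrable_massTot a b) q v
  refine h.congr_deriv ?_
  have hd : ∀ (a b : Idx) (X : ℝ), deriv (fun t : ℝ =>
      A.jac (q + t • v) X a i * A.jac (q + t • v) X b j) 0 =
      A.jacDot q v X a i * A.jac q X b j + A.jac q X a i * A.jacDot q v X b j := by
    intro a b X
    have := ((A.smoothFamily_jac a i).hasDerivAt q v X).fun_mul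
      ((A.smoothFamily_jac b j).hasDerivAt q v X)
    simpa [jacDot] using this.deriv
  have e1 : (A.C₂ q v)ᵀ i j = ∑ a, ∑ b, ∫ X in 0..A.total,
      A.massTot X a b * (A.jacDot q v X a i * A.jac q X b j) := by
    rw [← integral_triple A.intervalIntegrable_massTot (A.continuous_jacDot q v)
      (A.continuous_jac q)]
    refine intervalIntegral.integral_congr fun X hX => ?_
    rw [Set.uIcc_of_le A.total_nonneg] at hX
    change ((A.jac q X)ᵀ * A.massTot X * A.jacDot q v X)ᵀ i j = _
    rw [Matrix.transpose_mul, Matrix.transpose_mul, Matrix.transpose_transpose,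
      A.massTot_transpose hX, Matrix.mul_assoc]
  have e2 : A.C₂ q v i j = ∑ a, ∑ b, ∫ X in 0..A.total,
      A.massTot X a b * (A.jac q X a i * A.jacDot q v X b j) :=
    integral_triple A.intervalIntegrable_massTot (A.continuous_jac q) (A.continuous_jacDot q v) i j
  rw [Matrix.add_apply, e1, e2, ← Finset.sum_add_distrib]
  refine Finset.sum_congr rfl fun a _ => ?_
  rw [← Finset.sum_add_distrib]
  refine Finset.sum_congr rfl fun b _ => ?_
  rw [← intervalIntegral.integral_add]
  · refine intervalIntegral.integral_congr fun X _ => ?_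
    simp only [hd, mul_add]
  · exact (A.intervalIntegrable_massTot a b).mul_continuousOn
      ((A.continuous_jacDot q v a i).mul (A.continuous_jac q b j)).continuousOn
  · exact (A.intervalIntegrable_massTot a b).mul_continuousOn
      ((A.continuous_jac q a i).mul (A.continuous_jacDot q v b j)).continuousOn

/-! #### Coriolis and drag terms -/

theorem smoothFamily_coad (a b : Idx) :
    SmoothFamily fun (x : Joint N × Joint N) X => coad (A.jac x.1 X *ᵥ x.2) a b := by
  have h1 : ∀ i j, SmoothFamily fun (x : Joint N × Joint N) X =>
      hat (ang (A.jac x.1 X *ᵥ x.2)) i j :=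
    SmoothFamily.hat fun k => A.smoothFamily_jac_mulVec (Sum.inl k)
  have h2 : ∀ i j, SmoothFamily fun (x : Joint N × Joint N) X =>
      hat (lin (A.jac x.1 X *ᵥ x.2)) i j :=
    SmoothFamily.hat fun k => A.smoothFamily_jac_mulVec (Sum.inr k)
  rcases a with a | a <;> rcases b with b | b <;>
    simp only [coad, ad, Matrix.neg_apply, Matrix.transpose_apply, Matrix.fromBlocks_apply₁₁,
      Matrix.fromBlocks_apply₁₂, Matrix.fromBlocks_apply₂₁, Matrix.fromBlocks_apply₂₂,
      Matrix.zero_apply]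
  · exact (h1 b a).neg
  · exact (h2 b a).neg
  · exact (SmoothFamily.of_const 0).neg
  · exact (h1 b a).neg

theorem smoothFamily_coad_transpose_mul_jac (a : Idx) (i : Fin N × Idx) :
    SmoothFamily fun (x : Joint N × Joint N) X =>
      ((coad (A.jac x.1 X *ᵥ x.2))ᵀ * A.jac x.1 X) a i := by
  simp only [Matrix.mul_apply, Matrix.transpose_apply]
  exact SmoothFamily.sum _ fun b => (A.smoothFamily_coad b a).mul
    ((A.smoothFamily_jac b i).comp contDiff_fst)

/-- Absorbing `coad` into the left factor leaves `massTot` as the only non-continuous factor, as the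
triple-product lemmas require. -/
theorem C₁_eq (q v : Joint N) : A.C₁ q v = matInt 0 A.total fun X =>
    ((coad (A.jac q X *ᵥ v))ᵀ * A.jac q X)ᵀ * A.massTot X * A.jac q X := by
  simp only [C₁, Matrix.transpose_mul, Matrix.transpose_transpose]

theorem dotProduct_C₁_mulVec (q v : Joint N) : v ⬝ᵥ (A.C₁ q v *ᵥ v) = 0 := by
  rw [C₁_eq, dotProduct_matInt_mulVec (intervalIntegrable_triple A.intervalIntegrable_massTot
    (fun a i => (A.smoothFamily_coad_transpose_mul_jac a i).continuous (q, v))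
    (A.continuous_jac q))]
  refine (intervalIntegral.integral_congr fun X _ => ?_).trans intervalIntegral.integral_zero
  simp only [dotProduct_triple_mulVec]
  rw [← Matrix.mulVec_mulVec, Matrix.mulVec_transpose, ← Matrix.dotProduct_mulVec]
  exact dotProduct_coad_mulVec _ _

theorem contDiff_C₁ (i j : Fin N × Idx) :
    ContDiff ℝ ∞ fun x : Joint N × Joint N => A.C₁ x.1 x.2 i j := by
  have h : ∀ x : Joint N × Joint N, A.C₁ x.1 x.2 i j = ∑ a, ∑ b, ∫ X in 0..A.total,
      A.massTot X a b * (((coad (A.jac x.1 X *ᵥ x.2))ᵀ * A.jac x.1 X) a i * A.jac x.1 X b j) := by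
    intro x
    rw [C₁_eq]
    exact integral_triple A.intervalIntegrable_massTot
      (fun a i => (A.smoothFamily_coad_transpose_mul_jac a i).continuous x)
      (A.continuous_jac x.1) i j
  simp only [h]
  exact ContDiff.sum fun a _ => ContDiff.sum fun b _ =>
    ((A.smoothFamily_coad_transpose_mul_jac a i).mul
      ((A.smoothFamily_jac b j).comp contDiff_fst)).contDiff_weight
      (A.intervalIntegrable_massTot a b)

theorem contDiff_C₂ (i j : Fin N × Idx) :
    ContDiff ℝ ∞ fun x : Joint N × Joint N => A.C₂ x.1 x.2 i j := by
  have h : ∀ x : Joint N × Joint N, A.C₂ x.1 x.2 i j = ∑ a, ∑ b, ∫ X in 0..A.total,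
      A.massTot X a b * (A.jac x.1 X a i * A.jacDot x.1 x.2 X b j) := fun x =>
    integral_triple A.intervalIntegrable_massTot (A.continuous_jac x.1)
      (A.continuous_jacDot x.1 x.2) i j
  simp only [h]
  exact ContDiff.sum fun a _ => ContDiff.sum fun b _ =>
    (((A.smoothFamily_jac a i).comp contDiff_fst).mul
      (A.smoothFamily_jacDot b j)).contDiff_weight (A.intervalIntegrable_massTot a b)

theorem exists_smoothFamily_norm_eq_transNorm :
    ∃ g : Joint N × Joint N → ℝ → EuclideanSpace ℝ (Fin 3), SmoothFamily g ∧
      ∀ x X, ‖g x X‖ = transNorm (A.jac x.1 X *ᵥ x.2) := by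
  refine ⟨fun x X => ∑ k, lin (A.jac x.1 X *ᵥ x.2) k • EuclideanSpace.single k (1 : ℝ),
    SmoothFamily.sum _ fun k => (A.smoothFamily_jac_mulVec (Sum.inr k)).clm
      (ContinuousLinearMap.toSpanSingleton ℝ (EuclideanSpace.single k (1 : ℝ))), fun x X => ?_⟩
  rw [EuclideanSpace.norm_eq, transNorm]
  congr 1
  refine Finset.sum_congr rfl fun k _ => ?_
  simp [Finset.sum_apply, Pi.single_apply]

theorem continuous_transNorm (q v : Joint N) :
    Continuous fun X => transNorm (A.jac q X *ᵥ v) := by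
  obtain ⟨g, hg, h⟩ := A.exists_smoothFamily_norm_eq_transNorm
  simpa only [h] using (hg.continuous (q, v)).norm

theorem D_eq (q v : Joint N) : A.D q v = matInt 0 A.total fun X =>
    (transNorm (A.jac q X *ᵥ v) • A.jac q X)ᵀ * A.drag X * A.jac q X := by
  simp only [D, Matrix.transpose_smul, Matrix.smul_mul]

theorem continuous_transNorm_smul_jac (q v : Joint N) (a : Idx) (i : Fin N × Idx) :
    Continuous fun X => (transNorm (A.jac q X *ᵥ v) • A.jac q X) a i :=
  (A.continuous_transNorm q v).mul (A.continuous_jac q a i)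

theorem D_apply (q v : Joint N) (i j : Fin N × Idx) : A.D q v i j = ∑ a, ∑ b,
    ∫ X in 0..A.total, A.drag X a b *
      (transNorm (A.jac q X *ᵥ v) * A.jac q X a i * A.jac q X b j) := by
  rw [D_eq]
  exact integral_triple A.drag_int (A.continuous_transNorm_smul_jac q v) (A.continuous_jac q) i j

theorem dotProduct_D_mulVec_nonneg (q v : Joint N) : 0 ≤ v ⬝ᵥ (A.D q v *ᵥ v) := by
  have hint : ∀ i j, IntervalIntegrable (fun X => ((transNorm (A.jac q X *ᵥ v) • A.jac q X)ᵀ *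
      A.drag X * A.jac q X) i j) volume 0 A.total := intervalIntegrable_triple A.drag_int
    (A.continuous_transNorm_smul_jac q v) (A.continuous_jac q)
  rw [D_eq, dotProduct_matInt_mulVec hint]
  refine intervalIntegral.integral_nonneg A.total_nonneg fun X hX => ?_
  rw [dotProduct_triple_mulVec, Matrix.smul_mulVec, smul_dotProduct]
  exact mul_nonneg (Real.sqrt_nonneg _) (A.drag_nonneg X hX _)

/-- Each entry is an integral of drag against a smooth family times the norm of a smooth family;
this is the only term of the dynamics handled as merely Lipschitz. -/
theorem locallyLipschitz_D_mulVec :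
    LocallyLipschitz fun x : Joint N × Joint N => A.D x.1 x.2 *ᵥ x.2 := by
  obtain ⟨g, hg, hgn⟩ := A.exists_smoothFamily_norm_eq_transNorm
  refine locallyLipschitz_pi fun i => ?_
  have h : ∀ x : Joint N × Joint N, (A.D x.1 x.2 *ᵥ x.2) i = ∑ j, ∑ a, ∑ b,
      ∫ X in 0..A.total, A.drag X a b *
        (‖g x X‖ * (A.jac x.1 X a i * A.jac x.1 X b j * x.2 j)) := by
    intro x
    simp only [Matrix.mulVec, dotProduct]
    refine Finset.sum_congr rfl fun j _ => ?_
    rw [D_apply, Finset.sum_mul]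
    refine Finset.sum_congr rfl fun a _ => ?_
    rw [Finset.sum_mul]
    refine Finset.sum_congr rfl fun b _ => ?_
    rw [← intervalIntegral.integral_mul_const]
    refine intervalIntegral.integral_congr fun X _ => ?_
    simp only [hgn]
    ring
  simp only [h]
  exact LocallyLipschitz.finsetSum _ fun j => LocallyLipschitz.finsetSum _ fun a =>
    LocallyLipschitz.finsetSum _ fun b =>
      ((((A.smoothFamily_jac a i).comp contDiff_fst).mul
        ((A.smoothFamily_jac b j).comp contDiff_fst)).mul
        (SmoothFamily.of_contDiff (by fun_prop))).locallyLipschitz_weight_norm hg (A.drag_int a b)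

end Arm

open scoped ContDiff

/-! ### Smoothness of the inverse of a matrix family -/

section Inverse

variable {P n : Type*} [NormedAddCommGroup P] [NormedSpace ℝ P] [Fintype n]

theorem contDiff_mulVec {B : P → Matrix n n ℝ} {x : P → n → ℝ}
    (hB : ∀ i j, ContDiff ℝ ∞ fun p => B p i j) (hx : ContDiff ℝ ∞ x) :
    ContDiff ℝ ∞ fun p => B p *ᵥ x p :=
  contDiff_pi.2 fun i => ContDiff.sum fun j _ => (hB i j).mul (contDiff_pi.1 hx j)

variable [DecidableEq n]

theorem contDiff_det {B : P → Matrix n n ℝ} (hB : ∀ i j, ContDiff ℝ ∞ fun p => B p i j) :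
    ContDiff ℝ ∞ fun p => (B p).det := by
  simp only [Matrix.det_apply]
  exact ContDiff.sum fun σ _ => (contDiff_prod fun i _ => hB _ _).const_smul _

/-- Cramer's rule: adjugate entries are determinants, divided by a nonvanishing determinant. -/
theorem contDiff_inv_apply {B : P → Matrix n n ℝ} (hB : ∀ i j, ContDiff ℝ ∞ fun p => B p i j)
    (hu : ∀ p, IsUnit (B p).det) (i j : n) : ContDiff ℝ ∞ fun p => (B p)⁻¹ i j := by
  simp only [Matrix.inv_def, Ring.inverse_eq_inv', Matrix.smul_apply, smul_eq_mul,
    Matrix.adjugate_apply]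
  refine ((contDiff_det hB).inv fun p => (hu p).ne_zero).mul (contDiff_det fun k l => ?_)
  by_cases hk : k = j
  · subst hk
    simpa using contDiff_const
  · simpa [Matrix.updateRow_ne hk] using hB k l

end Inverse

namespace Arm

variable {N : ℕ} (A : Arm N)

/-! #### The closed loop -/

section ClosedLoop

variable (Kp KD : Matrix (Fin N × Idx) (Fin N × Idx) ℝ) (qd : Joint N)

/-- The force that accelerates the arm in closed loop, without gravity. -/
def closedLoopForce (x : Joint N × Joint N) : Joint N :=
  -(Kp *ᵥ (x.1 - qd)) - KD *ᵥ x.2 - (A.C₁ x.1 x.2 + A.C₂ x.1 x.2) *ᵥ x.2 - A.D x.1 x.2 *ᵥ x.2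

/-- The vector field of the closed loop, without gravity. -/
def closedLoop (x : Joint N × Joint N) : Joint N × Joint N :=
  (x.2, (A.M x.1)⁻¹ *ᵥ A.closedLoopForce Kp KD qd x)

/-- Kinetic energy plus the potential energy of the proportional action. -/
def energy (x : Joint N × Joint N) : ℝ :=
  (1 / 2) * (x.2 ⬝ᵥ (A.M x.1 *ᵥ x.2)) + (1 / 2) * ((x.1 - qd) ⬝ᵥ (Kp *ᵥ (x.1 - qd)))

/-- The control cancels `F`, the load vanishes, and `M` is invertible, so the implicit equation can
be solved for the acceleration. -/
theorem isMotion_pdLaw_iff (hgrav : ∀ q, A.gravLoad q = 0) (I : Set ℝ)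
    (z : ℝ → Joint N × Joint N) :
    A.IsMotion (A.pdLaw Kp KD qd) I z ↔ IsSol (A.closedLoop Kp KD qd) I z := by
  have key : ∀ (x : Joint N × Joint N) (acc : Joint N),
      A.M x.1 *ᵥ acc + (A.C₁ x.1 x.2 + A.C₂ x.1 x.2) *ᵥ x.2 =
        A.pdLaw Kp KD qd x.1 x.2 + A.F x.1 + A.gravLoad x.1 - A.D x.1 x.2 *ᵥ x.2 ↔
      acc = (A.M x.1)⁻¹ *ᵥ A.closedLoopForce Kp KD qd x := by
    intro x acc
    have h1 : A.pdLaw Kp KD qd x.1 x.2 + A.F x.1 + A.gravLoad x.1 - A.D x.1 x.2 *ᵥ x.2 =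
        A.closedLoopForce Kp KD qd x + (A.C₁ x.1 x.2 + A.C₂ x.1 x.2) *ᵥ x.2 := by
      rw [hgrav, pdLaw, closedLoopForce]
      abel
    rw [h1, add_left_inj]
    constructor
    · intro h
      rw [← h, Matrix.mulVec_mulVec, Matrix.nonsing_inv_mul _ (A.isUnit_det_M _),
        Matrix.one_mulVec]
    · rintro rfl
      rw [Matrix.mulVec_mulVec, Matrix.mul_nonsing_inv _ (A.isUnit_det_M _), Matrix.one_mulVec]
  constructor
  · rintro ⟨acc, h⟩ t ht
    obtain ⟨hd, he⟩ := h t ht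
    rwa [(key _ _).1 he] at hd
  · intro h
    exact ⟨fun t => (A.M (z t).1)⁻¹ *ᵥ A.closedLoopForce Kp KD qd (z t), fun t ht =>
      ⟨h t ht, (key _ _).2 rfl⟩⟩

theorem contDiff_smooth_force : ContDiff ℝ ∞ fun x : Joint N × Joint N =>
    -(Kp *ᵥ (x.1 - qd)) - KD *ᵥ x.2 - (A.C₁ x.1 x.2 + A.C₂ x.1 x.2) *ᵥ x.2 := by
  have hp : ContDiff ℝ ∞ fun x : Joint N × Joint N => Kp *ᵥ (x.1 - qd) :=
    contDiff_mulVec (fun _ _ => contDiff_const) (contDiff_fst.sub contDiff_const)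
  have hd : ContDiff ℝ ∞ fun x : Joint N × Joint N => KD *ᵥ x.2 :=
    contDiff_mulVec (fun _ _ => contDiff_const) contDiff_snd
  have hC : ContDiff ℝ ∞ fun x : Joint N × Joint N => (A.C₁ x.1 x.2 + A.C₂ x.1 x.2) *ᵥ x.2 := by
    refine contDiff_mulVec (fun i j => ?_) contDiff_snd
    simp only [Matrix.add_apply]
    exact (A.contDiff_C₁ i j).add (A.contDiff_C₂ i j)
  exact (hp.neg.sub hd).sub hC

/-- The field is a smooth map composed with `x ↦ (x, D v)`, which confines the lack of smoothness to
the drag. -/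
theorem locallyLipschitz_inv_M_mulVec_sub_D {S : Joint N × Joint N → Joint N}
    (hS : ContDiff ℝ ∞ S) :
    LocallyLipschitz fun x => (x.2, (A.M x.1)⁻¹ *ᵥ (S x - A.D x.1 x.2 *ᵥ x.2)) := by
  have h1 : ContDiff ℝ ∞ fun y : (Joint N × Joint N) × Joint N => S y.1 - y.2 :=
    (hS.comp contDiff_fst).sub contDiff_snd
  have h2 : ∀ i j, ContDiff ℝ ∞ fun y : (Joint N × Joint N) × Joint N =>
      (A.M y.1.1)⁻¹ i j := fun i j =>
    (contDiff_inv_apply A.contDiff_M A.isUnit_det_M i j).comp (contDiff_fst.comp contDiff_fst)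
  have h3 : ContDiff ℝ ∞ fun y : (Joint N × Joint N) × Joint N =>
      (y.1.2, (A.M y.1.1)⁻¹ *ᵥ (S y.1 - y.2)) :=
    (contDiff_snd.comp contDiff_fst).prodMk (contDiff_mulVec h2 h1)
  have h4 : LocallyLipschitz fun x : Joint N × Joint N => (x, A.D x.1 x.2 *ᵥ x.2) :=
    LocallyLipschitz.id.prodMk A.locallyLipschitz_D_mulVec
  have h5 := (h3.of_le (m := 1) (by simp)).locallyLipschitz
  simpa only [Function.comp_def] using h5.comp h4

theorem locallyLipschitz_closedLoop : LocallyLipschitz (A.closedLoop Kp KD qd) :=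
  A.locallyLipschitz_inv_M_mulVec_sub_D (A.contDiff_smooth_force Kp KD qd)

theorem contDiff_energy : ContDiff ℝ ∞ (A.energy Kp qd) := by
  have hdot : ∀ {f g : Joint N × Joint N → Joint N}, ContDiff ℝ ∞ f → ContDiff ℝ ∞ g →
      ContDiff ℝ ∞ fun x => f x ⬝ᵥ g x := fun hf hg =>
    ContDiff.sum fun i _ => (contDiff_pi.1 hf i).mul (contDiff_pi.1 hg i)
  unfold energy
  refine (contDiff_const.mul (hdot contDiff_snd (contDiff_mulVec (fun i j =>
    (A.contDiff_M i j).comp contDiff_fst) contDiff_snd))).add (contDiff_const.mul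
    (hdot (by fun_prop) (contDiff_mulVec (fun _ _ => contDiff_const) (by fun_prop))))

theorem hasFDerivAt_energy (x : Joint N × Joint N) :
    HasFDerivAt (A.energy Kp qd) (fderiv ℝ (A.energy Kp qd) x) x :=
  ((A.contDiff_energy Kp qd).differentiable (by simp) x).hasFDerivAt

/-- The energy balance. -/
theorem fderiv_energy_closedLoop (hKp : Kpᵀ = Kp) (x : Joint N × Joint N) :
    fderiv ℝ (A.energy Kp qd) x (A.closedLoop Kp KD qd x) =
      -(x.2 ⬝ᵥ (KD *ᵥ x.2)) - x.2 ⬝ᵥ (A.D x.1 x.2 *ᵥ x.2) := by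
  obtain ⟨q, v⟩ := x
  set w := (A.M q)⁻¹ *ᵥ A.closedLoopForce Kp KD qd (q, v) with hw
  have hMw : A.M q *ᵥ w = A.closedLoopForce Kp KD qd (q, v) := by
    rw [hw, Matrix.mulVec_mulVec, Matrix.mul_nonsing_inv _ (A.isUnit_det_M _), Matrix.one_mulVec]
  have hsymm : ∀ {B : Matrix (Fin N × Idx) (Fin N × Idx) ℝ} (_ : Bᵀ = B) (a b : Joint N),
      a ⬝ᵥ (B *ᵥ b) = b ⬝ᵥ (B *ᵥ a) := by
    intro B hB a b
    rw [Matrix.dotProduct_mulVec, ← Matrix.mulVec_transpose, hB, dotProduct_comm]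
  have hline : HasDerivAt (fun t : ℝ => (q, v) + t • (v, w)) (v, w) 0 := by
    simpa using ((hasDerivAt_id (0 : ℝ)).smul_const (v, w)).const_add (q, v)
  -- The derivative in the direction of the field is computed twice along a straight line, once
  -- abstractly and once by the product rule.
  have h1 : HasDerivAt (fun t : ℝ => A.energy Kp qd ((q, v) + t • (v, w)))
      (fderiv ℝ (A.energy Kp qd) (q, v) (v, w)) 0 := by
    have hf : HasFDerivAt (A.energy Kp qd) (fderiv ℝ (A.energy Kp qd) (q, v))
        ((q, v) + (0 : ℝ) • (v, w)) := by
      rw [zero_smul, add_zero]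
      exact A.hasFDerivAt_energy Kp qd (q, v)
    exact hf.comp_hasDerivAt 0 hline
  have hv : ∀ i, HasDerivAt (fun t : ℝ => (v + t • w) i) (w i) 0 := fun i => by
    simpa using ((hasDerivAt_id (0 : ℝ)).mul_const (w i)).const_add (v i)
  have hq : ∀ i, HasDerivAt (fun t : ℝ => (q + t • v - qd) i) (v i) 0 := fun i => by
    simpa using (((hasDerivAt_id (0 : ℝ)).mul_const (v i)).const_add (q i)).sub_const (qd i)
  have h2 : HasDerivAt (fun t : ℝ => A.energy Kp qd ((q, v) + t • (v, w)))
      (v ⬝ᵥ (A.M q *ᵥ w) + v ⬝ᵥ (A.C₂ q v *ᵥ v) + v ⬝ᵥ (Kp *ᵥ (q - qd))) 0 := by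
    have h := ((HasDerivAt.dotProduct_mulVec hv hv (A.hasDerivAt_M q v)).const_mul
      (1 / 2 : ℝ)).add ((HasDerivAt.dotProduct_mulVec hq hq (B := fun _ => Kp) (B' := 0)
        fun i j => hasDerivAt_const _ _).const_mul (1 / 2 : ℝ))
    refine h.congr_deriv ?_
    have e1 : v ⬝ᵥ ((A.C₂ q v)ᵀ *ᵥ v) = v ⬝ᵥ (A.C₂ q v *ᵥ v) := by
      rw [Matrix.mulVec_transpose, ← dotProduct_comm, ← Matrix.dotProduct_mulVec]
    simp only [zero_smul, add_zero, Matrix.zero_mulVec, dotProduct_zero, Matrix.add_mulVec,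
      dotProduct_add, e1]
    rw [hsymm (A.M_transpose q) w v, hsymm hKp (q - qd) v]
    ring
  refine (h1.unique h2).trans ?_
  -- Substituting `M w` cancels the `C₂` and `K_p` terms, and `C₁` does no work; only damping and
  -- drag remain.
  rw [hMw, closedLoopForce]
  simp only [dotProduct_sub, dotProduct_neg, Matrix.add_mulVec, dotProduct_add,
    A.dotProduct_C₁_mulVec]
  ring

end ClosedLoop

/-! ### Properness of the energy and LaSalle's argument for a diagonal `K_p` -/

section Diagonal

variable {kp : Fin N × Idx → ℝ} (qd : Joint N)

theorem dotProduct_diagonal_mulVec_pos {n : Type*} [Fintype n] [DecidableEq n] {d : n → ℝ}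
    (hd : ∀ i, 0 < d i) {v : n → ℝ} (hv : v ≠ 0) : 0 < v ⬝ᵥ (Matrix.diagonal d *ᵥ v) := by
  simpa using (Matrix.PosDef.diagonal hd).dotProduct_mulVec_pos hv

/-- The spring energy confines `q` to a ball. On that compact ball `M` is uniformly positive
definite, so the kinetic energy then bounds `v`. -/
theorem isCompact_energy_le (hkp : ∀ i, 0 < kp i) (c : ℝ) :
    IsCompact {x | A.energy (Matrix.diagonal kp) qd x ≤ c} := by
  -- A constant family over a one-point parameter space, since `K_p` does not depend on `q`.
  obtain ⟨k, hk, hkb⟩ := exists_mul_sq_norm_le (isCompact_singleton (x := (0 : ℝ)))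
    (B := fun _ => Matrix.diagonal kp) (fun _ _ => continuous_const)
    fun _ _ v hv => dotProduct_diagonal_mulVec_pos hkp hv
  obtain ⟨m, hm, hmb⟩ := exists_mul_sq_norm_le (isCompact_closedBall qd (√(2 * c / k)))
    (fun i j => (A.contDiff_M i j).continuous) fun q _ v hv => A.M_pos q hv
  refine ((isCompact_closedBall qd (√(2 * c / k))).prod
    (isCompact_closedBall (0 : Joint N) (√(2 * c / m)))).of_isClosed_subset
    (isClosed_le (A.contDiff_energy _ qd).continuous continuous_const) ?_
  rintro ⟨q, v⟩ hx
  have hx' : (1 / 2) * (v ⬝ᵥ (A.M q *ᵥ v)) +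
    (1 / 2) * ((q - qd) ⬝ᵥ (Matrix.diagonal kp *ᵥ (q - qd))) ≤ c := hx
  have h1 := hkb 0 rfl (q - qd)
  have hM0 : 0 ≤ v ⬝ᵥ (A.M q *ᵥ v) := by
    rcases eq_or_ne v 0 with rfl | hv
    · simp
    · exact (A.M_pos q hv).le
  have hq : q ∈ Metric.closedBall qd (√(2 * c / k)) := by
    rw [mem_closedBall_iff_norm]
    refine Real.le_sqrt_of_sq_le ?_
    rw [le_div_iff₀ hk]
    linarith
  refine ⟨hq, ?_⟩
  have h2 := hmb q hq v
  rw [mem_closedBall_iff_norm, sub_zero]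
  refine Real.le_sqrt_of_sq_le ?_
  rw [le_div_iff₀ hm]
  have : 0 ≤ k * ‖q - qd‖ ^ 2 := by positivity
  change ‖v‖ ^ 2 * m ≤ _
  linarith

theorem energy_lt_of_ne (hkp : ∀ i, 0 < kp i) {x : Joint N × Joint N} (hx : x ≠ (qd, 0)) :
    A.energy (Matrix.diagonal kp) qd (qd, 0) < A.energy (Matrix.diagonal kp) qd x := by
  obtain ⟨q, v⟩ := x
  have h0 : A.energy (Matrix.diagonal kp) qd (qd, 0) = 0 := by simp [energy]
  rw [h0, energy]
  rcases eq_or_ne v 0 with rfl | hv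
  · have hq : q - qd ≠ 0 := fun h => hx (by rw [sub_eq_zero.1 h])
    have := dotProduct_diagonal_mulVec_pos hkp hq
    simpa using this
  · have h1 := A.M_pos q hv
    have h2 : 0 ≤ (q - qd) ⬝ᵥ (Matrix.diagonal kp *ᵥ (q - qd)) := by
      rcases eq_or_ne (q - qd) 0 with hq | hq
      · simp [hq]
      · exact (dotProduct_diagonal_mulVec_pos hkp hq).le
    simp only
    linarith

theorem closedLoop_velocity_zero (Kp KD : Matrix (Fin N × Idx) (Fin N × Idx) ℝ)
    (q : Joint N) :
    A.closedLoop Kp KD qd (q, 0) = (0, (A.M q)⁻¹ *ᵥ -(Kp *ᵥ (q - qd))) := by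
  simp [closedLoop, closedLoopForce]

theorem isGAS_closedLoop (hkp : ∀ i, 0 < kp i) (KD : Matrix (Fin N × Idx) (Fin N × Idx) ℝ)
    (hKD : ∀ v : Joint N, v ≠ 0 → 0 < v ⬝ᵥ (KD *ᵥ v)) :
    IsGAS (IsSol (A.closedLoop (Matrix.diagonal kp) KD qd)) (qd, 0) := by
  have hbal := A.fderiv_energy_closedLoop (Matrix.diagonal kp) KD qd
    (Matrix.diagonal_transpose kp)
  refine isGAS_of_lyapunov (A.locallyLipschitz_closedLoop _ KD qd)
    (A.hasFDerivAt_energy (Matrix.diagonal kp) qd) (fun x => ?_) (A.isCompact_energy_le qd hkp)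
    (fun x hx => A.energy_lt_of_ne qd hkp hx) ?_ fun y hy hzero => ?_
  · rw [hbal]
    have h1 := A.dotProduct_D_mulVec_nonneg x.1 x.2
    have h2 : 0 ≤ x.2 ⬝ᵥ (KD *ᵥ x.2) := by
      rcases eq_or_ne x.2 0 with hv | hv
      · simp [hv]
      · exact (hKD _ hv).le
    linarith
  · rw [closedLoop_velocity_zero]
    simp
  · have hvel : ∀ t, 0 ≤ t → (y t).2 = 0 := by
      intro t ht
      by_contra hv
      have h := hzero t ht
      rw [hbal] at h
      linarith [A.dotProduct_D_mulVec_nonneg (y t).1 (y t).2, hKD _ hv]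
    -- At time `0` the velocity has as right derivative both the closed-loop acceleration and `0`.
    have h0 := (hasFDerivAt_snd (𝕜 := ℝ) (p := y 0)).comp_hasDerivWithinAt (0 : ℝ)
      (hy 0 Set.self_mem_Ici)
    have h0' : HasDerivWithinAt (fun t => (y t).2) 0 (Set.Ici 0) 0 :=
      (hasDerivWithinAt_const (0 : ℝ) (Set.Ici 0) (0 : Joint N)).congr
        (fun t ht => hvel t ht) (hvel 0 le_rfl)
    have hacc := (uniqueDiffOn_Ici (0 : ℝ) 0 Set.self_mem_Ici).eq_deriv _ h0 h0'
    have hy0 : y 0 = ((y 0).1, 0) := Prod.ext rfl (hvel 0 le_rfl)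
    rw [hy0, closedLoop_velocity_zero] at hacc
    have hK : Matrix.diagonal kp *ᵥ ((y 0).1 - qd) = 0 := by
      have := congrArg (A.M (y 0).1 *ᵥ ·) hacc
      simp only [ContinuousLinearMap.coe_snd'] at this
      rw [Matrix.mulVec_mulVec, Matrix.mul_nonsing_inv _ (A.isUnit_det_M _), Matrix.one_mulVec,
        Matrix.mulVec_zero] at this
      exact neg_eq_zero.1 this
    rw [hy0]
    refine Prod.ext ?_ rfl
    by_contra hne
    have := dotProduct_diagonal_mulVec_pos hkp (sub_ne_zero.2 hne)
    rw [hK, dotProduct_zero] at this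
    exact lt_irrefl _ this

end Diagonal

end Arm

end PCS

end

theorem mainTheorem2 (N : ℕ) (A : PCS.Arm N)
    (kp : Fin N × PCS.Idx → ℝ) (hkp : ∀ i, 0 < kp i)
    (KD : Matrix (Fin N × PCS.Idx) (Fin N × PCS.Idx) ℝ)
    (hKD : ∀ v : PCS.Joint N, v ≠ 0 → 0 < v ⬝ᵥ (KD *ᵥ v))
    (hgrav : ∀ q, A.gravLoad q = 0)
    (qd : PCS.Joint N) :
    PCS.IsGAS (A.IsMotion (A.pdLaw (Matrix.diagonal kp) KD qd)) (qd, 0) := by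
  have h : A.IsMotion (A.pdLaw (Matrix.diagonal kp) KD qd) =
      PCS.IsSol (A.closedLoop (Matrix.diagonal kp) KD qd) := by
    funext I z
    exact propext (A.isMotion_pdLaw_iff _ KD qd hgrav I z)
  rw [h]
  exact A.isGAS_closedLoop qd hkp KD hKD
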